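/- Let $\mathcal M$ be the tetrahedral map $\{3,3\}$ on the sphere, let $G=\mathrm{Aut}^+\mathcal M\cong A_4$ be its orientation-preserving automorphism group, and let $p\neq 2$ be a prime. Let $\rho_1$ be the principal representation of $G$ over $\mathbb F_p$ and let $\rho_4$ be the reduction mod $p$ of the natural $3$-dimensional representation of $G$ as the rotation group of the tetrahedron; $\rho_4$ is irreducible over $\mathbb F_p$. Let $S'$ be the sphere punctured at the set $\Phi'$ of the four vertices and four face-centres of $\mathcal M$, and let $Q'=H_1(S';\mathbb F_p)$. (a) As $G$-modules, $Q'\cong \mathbb F_p\Phi'/\langle\sum_{\phi\in\Phi'}\phi\rangle$, and $Q'$ affords $\rho_1\oplus\rho_4\oplus\rho_4$. (b) Consider the orientably regular maps $\mathcal N$ with a regular covering $\mathcal N\to\mathcal M$ whose covering group $K$ is an elementary abelian $p$-group of rank $c\ge 1$ and which is branched at most over the vertices and face-centres of $\mathcal M$. Up to isomorphism (of coverings, or equivalently of the maps $\mathcal N$) there are exactly $2p+5$ of these: one with $c=1$, $p+1$ with $c=3$, $p+1$ with $c=4$, one with $c=6$ and one with $c=7$. The representations of $G$ that they afford (by the conjugation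 action on $K$) are respectively $\rho_1$, $\rho_4$, $\rho_1\oplus\rho_4$, $\rho_4\oplus\rho_4$ and $\rho_1\oplus\rho_4\oplus\rho_4$. All these maps $\mathcal N$ are regular, that is, isomorphic to their mirror images. (c) Exactly one of these coverings is unbranched over the vertices, and exactly one is unbranched over the face-centres. Both have $c=3$ and genus $p^3-2p^2+1$; they have types $\{3p,3\}$ and $\{3,3p\}$ respectively, and the second map is the dual of the first. Each of the remaining $2p+3$ coverings has type $\{3p,3p\}$ and genus $3p^c-4p^{c-1}+1$. (Here type $\{n,m\}$ means that all faces are $n$-gons and all vertices have valency $m$.) -/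

import Mathlib

/-- A finite oriented map on a compact connected oriented surface without boundary, given by its
set of darts (directed edges), the anticlockwise rotation `rot` of the darts about their initial
vertices, and the fixed-point-free involution `inv` reversing each dart. -/
structure OMap where
  Dart : Type
  finite_dart : Finite Dart
  nonempty_dart : Nonempty Dart
  rot : Equiv.Perm Dart
  inv : Equiv.Perm Dart
  inv_inv : ∀ d, inv (inv d) = d
  inv_ne : ∀ d, inv d ≠ d
  connected : ∀ a b : Dart, ∃ g ∈ Subgroup.closure {rot, inv}, g a = b

namespace OMap

/-- The anticlockwise rotation of the darts about the faces, so that `rot * inv * face = 1`. -/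
def face (M : OMap) : Equiv.Perm M.Dart := (M.rot * M.inv)⁻¹

/-- The vertices: cycles of `rot`. -/
abbrev Vertex (M : OMap) : Type := Quotient (Equiv.Perm.SameCycle.setoid M.rot)

/-- The edges: cycles of `inv`. -/
abbrev Edge (M : OMap) : Type := Quotient (Equiv.Perm.SameCycle.setoid M.inv)

/-- The faces (equivalently, their centres): cycles of `face`. -/
abbrev Face (M : OMap) : Type := Quotient (Equiv.Perm.SameCycle.setoid M.face)

/-- Type `{n, m}`: every face is an `n`-gon and every vertex has valency `m`. -/
def HasType (M : OMap) (n m : ℕ) : Prop :=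
  (∀ d, Function.minimalPeriod M.face d = n) ∧ (∀ d, Function.minimalPeriod M.rot d = m)

/-- The underlying surface has genus `g`, that is, Euler characteristic `2 - 2 * g`. -/
def HasGenus (M : OMap) (g : ℤ) : Prop :=
  (Nat.card M.Vertex : ℤ) - Nat.card M.Edge + Nat.card M.Face = 2 - 2 * g

/-- The orientation-preserving automorphism group `Aut⁺ M`. -/
def aut (M : OMap) : Subgroup (Equiv.Perm M.Dart) := Subgroup.centralizer {M.rot, M.inv}

theorem aut_rot {M : OMap} (g : M.aut) (d : M.Dart) : g.1 (M.rot d) = M.rot (g.1 d) :=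
  (DFunLike.congr_fun (Subgroup.mem_centralizer_iff.1 g.2 M.rot (by simp)) d).symm

theorem aut_inv {M : OMap} (g : M.aut) (d : M.Dart) : g.1 (M.inv d) = M.inv (g.1 d) :=
  (DFunLike.congr_fun (Subgroup.mem_centralizer_iff.1 g.2 M.inv (by simp)) d).symm

/-- `Aut⁺ M` is transitive on directed edges. -/
def IsOrientablyRegular (M : OMap) : Prop := ∀ a b : M.Dart, ∃ g : M.aut, g.1 a = b

/-- Orientation-preserving isomorphisms of maps. -/
structure Iso (N M : OMap) where
  toEquiv : N.Dart ≃ M.Dart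
  map_rot : ∀ d, toEquiv (N.rot d) = M.rot (toEquiv d)
  map_inv : ∀ d, toEquiv (N.inv d) = M.inv (toEquiv d)

/-- The mirror image: the same map with the orientation of the surface reversed. -/
def mirror (M : OMap) : OMap where
  Dart := M.Dart
  finite_dart := M.finite_dart
  nonempty_dart := M.nonempty_dart
  rot := M.rot⁻¹
  inv := M.inv
  inv_inv := M.inv_inv
  inv_ne := M.inv_ne
  connected := by
    intro a b
    obtain ⟨g, hg, h⟩ := M.connected a b
    refine ⟨g, ?_, h⟩
    refine (Subgroup.closure_le _).2 ?_ hg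
    rintro k (rfl | rfl)
    · exact (Subgroup.inv_mem_iff _).1 (Subgroup.subset_closure (by simp))
    · exact Subgroup.subset_closure (by simp)

/-- The dual map: vertices and faces are interchanged. -/
def dual (M : OMap) : OMap where
  Dart := M.Dart
  finite_dart := M.finite_dart
  nonempty_dart := M.nonempty_dart
  rot := M.face
  inv := M.inv
  inv_inv := M.inv_inv
  inv_ne := M.inv_ne
  connected := by
    intro a b
    obtain ⟨g, hg, h⟩ := M.connected a b
    refine ⟨g, ?_, h⟩
    have h1 : M.face ∈ Subgroup.closure {M.face, M.inv} := Subgroup.subset_closure (by simp)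
    have h2 : M.inv ∈ Subgroup.closure {M.face, M.inv} := Subgroup.subset_closure (by simp)
    refine (Subgroup.closure_le _).2 ?_ hg
    rintro k (rfl | rfl)
    · have : M.rot = M.face⁻¹ * M.inv⁻¹ := by simp [face]
      rw [this]
      exact mul_mem (inv_mem h1) (inv_mem h2)
    · exact h2

/-- A map is regular if it is orientably regular and isomorphic to its mirror image. -/
def IsRegular (M : OMap) : Prop := M.IsOrientablyRegular ∧ Nonempty (M.Iso M.mirror)

/-- Coverings of maps. As both reversals are free of fixed points, there is no branching over the
edges; branching is possible only over vertices and face-centres. -/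
structure Cov (N M : OMap) where
  toFun : N.Dart → M.Dart
  map_rot : ∀ d, toFun (N.rot d) = M.rot (toFun d)
  map_inv : ∀ d, toFun (N.inv d) = M.inv (toFun d)

/-- The group of covering transformations. -/
def Cov.deck {N M : OMap} (f : N.Cov M) : Subgroup N.aut where
  carrier := {g | ∀ d, f.toFun (g.1 d) = f.toFun d}
  one_mem' := fun _ => rfl
  mul_mem' := by
    intro a b ha hb d
    exact (ha (b.1 d)).trans (hb d)
  inv_mem' := by
    intro a ha d
    have := ha ((a⁻¹).1 d)
    simpa using this.symm

/-- The orientably regular coverings of `M`, branched at most over vertices and face-centres, that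
are regular coverings with a nontrivial elementary abelian `p`-group as covering group. -/
structure ElemAbCover (p : ℕ) (M : OMap) where
  total : OMap
  proj : total.Cov M
  orientablyRegular : total.IsOrientablyRegular
  deck_transitive : ∀ a b, proj.toFun a = proj.toFun b → ∃ g ∈ proj.deck, g.1 a = b
  deck_comm : ∀ a b : proj.deck, a * b = b * a
  deck_exponent : ∀ a : proj.deck, a ^ p = 1
  deck_nontrivial : Nontrivial proj.deck

namespace ElemAbCover

variable {p : ℕ} {M : OMap}

/-- The covering group has rank `c`. -/
def HasRank (N : ElemAbCover p M) (c : ℕ) : Prop := Nat.card N.proj.deck = p ^ c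

/-- No branching over the vertices of `M`. -/
def UnbranchedOverVertices (N : ElemAbCover p M) : Prop :=
  ∀ d, Function.minimalPeriod N.total.rot d = Function.minimalPeriod M.rot (N.proj.toFun d)

/-- No branching over the face-centres of `M`. -/
def UnbranchedOverFaces (N : ElemAbCover p M) : Prop :=
  ∀ d, Function.minimalPeriod N.total.face d = Function.minimalPeriod M.face (N.proj.toFun d)

/-- The covering group `K`, with `Aut⁺ M` acting on it by conjugation by lifted automorphisms, is
isomorphic to the module of the representation `ρ`. -/
def Affords (N : ElemAbCover p M) {V : Type} [AddCommGroup V] [Module (ZMod p) V]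
    (ρ : Representation (ZMod p) M.aut V) : Prop :=
  ∃ κ : N.proj.deck ≃* Multiplicative V,
    ∀ (g : M.aut) (h : N.total.aut),
      (∀ d, N.proj.toFun (h.1 d) = g.1 (N.proj.toFun d)) →
      ∀ k k' : N.proj.deck, (k' : N.total.aut) = h * k * h⁻¹ →
        (κ k').toAdd = ρ g (κ k).toAdd

/-- Isomorphism of coverings: an isomorphism of maps commuting with the projections to `M`. -/
def Equivalent (N N' : ElemAbCover p M) : Prop :=
  ∃ φ : N.total.Iso N'.total, ∀ d, N'.proj.toFun (φ.toEquiv d) = N.proj.toFun d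

theorem equivalent_equivalence : Equivalence (Equivalent (p := p) (M := M)) where
  refl N := ⟨⟨Equiv.refl _, fun _ => rfl, fun _ => rfl⟩, fun _ => rfl⟩
  symm := by
    rintro N N' ⟨φ, h⟩
    refine ⟨⟨φ.toEquiv.symm, fun d => ?_, fun d => ?_⟩, fun d => ?_⟩
    · rw [Equiv.symm_apply_eq, φ.map_rot, Equiv.apply_symm_apply]
    · rw [Equiv.symm_apply_eq, φ.map_inv, Equiv.apply_symm_apply]
    · rw [← h, Equiv.apply_symm_apply]
  trans := by
    rintro N N' N'' ⟨φ, h⟩ ⟨ψ, k⟩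
    refine ⟨⟨φ.toEquiv.trans ψ.toEquiv, fun d => ?_, fun d => ?_⟩, fun d => ?_⟩
    · simp [φ.map_rot, ψ.map_rot]
    · simp [φ.map_inv, ψ.map_inv]
    · simp [h, k]

/-- The isomorphism classes of coverings. -/
def Classes (p : ℕ) (M : OMap) : Type 1 :=
  Quotient (⟨Equivalent, equivalent_equivalence⟩ : Setoid (ElemAbCover p M))

/-- The isomorphism class of a covering. -/
def cls (N : ElemAbCover p M) : Classes p M :=
  Quotient.mk (⟨Equivalent, equivalent_equivalence⟩ : Setoid (ElemAbCover p M)) N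

/-- The isomorphism classes of coverings of rank `c`. -/
def ClassesOfRank (p : ℕ) (M : OMap) (c : ℕ) : Type 1 :=
  {q : Classes p M // ∃ N : ElemAbCover p M, N.cls = q ∧ N.HasRank c}

end ElemAbCover

/-! ### Homology of the surface punctured at the vertices and face-centres

The medial graph of `M` has the midpoints of the edges of `M` as its vertices, and one directed
edge for each dart `d` (the corner at the initial vertex of `d`, between `d` and `rot d`), from the
edge of `d` to the edge of `rot d`. The medial graph is the 1-skeleton of a cell decomposition of
the surface with exactly one 2-cell around each vertex and each face-centre of `M`; hence the
surface punctured at the vertices and face-centres retracts equivariantly onto it, and the cellular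
chain complex of the punctured surface is `0 → C₁ → C₀` with the boundary map below. -/

/-- The cellular boundary map `C₁ → C₀` with coefficients in `𝔽_p`. -/
noncomputable def boundary (p : ℕ) (M : OMap) :
    (M.Dart →₀ ZMod p) →ₗ[ZMod p] (M.Edge →₀ ZMod p) :=
  Finsupp.lmapDomain (ZMod p) (ZMod p) (fun d => (⟦M.rot d⟧ : M.Edge)) -
    Finsupp.lmapDomain (ZMod p) (ZMod p) (fun d => (⟦d⟧ : M.Edge))

/-- The action of `Aut⁺ M` on the 1-chains. -/
noncomputable def chainRep (p : ℕ) (M : OMap) :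
    Representation (ZMod p) M.aut (M.Dart →₀ ZMod p) where
  toFun g := Finsupp.lmapDomain (ZMod p) (ZMod p) (g.1 : M.Dart → M.Dart)
  map_one' := by ext; simp
  map_mul' a b := by ext; simp

/-- Automorphisms of `M` act on its edges. -/
def autEdge {M : OMap} (g : M.aut) : M.Edge → M.Edge :=
  Quotient.map g.1 (by
    rintro a b ⟨n, rfl⟩
    refine ⟨n, ?_⟩
    have hc : Commute (M.inv ^ n) g.1 :=
      Commute.zpow_left (Subgroup.mem_centralizer_iff.1 g.2 M.inv (by simp)) n
    exact DFunLike.congr_fun hc.eq a)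

/-- Automorphisms of `M` act on its vertices. -/
def autVertex {M : OMap} (g : M.aut) : M.Vertex → M.Vertex :=
  Quotient.map g.1 (by
    rintro a b ⟨n, rfl⟩
    refine ⟨n, ?_⟩
    have hc : Commute (M.rot ^ n) g.1 :=
      Commute.zpow_left (Subgroup.mem_centralizer_iff.1 g.2 M.rot (by simp)) n
    exact DFunLike.congr_fun hc.eq a)

/-- Automorphisms of `M` act on its faces. -/
def autFace {M : OMap} (g : M.aut) : M.Face → M.Face :=
  Quotient.map g.1 (by
    rintro a b ⟨n, rfl⟩
    refine ⟨n, ?_⟩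
    have h1 : Commute M.rot g.1 := Subgroup.mem_centralizer_iff.1 g.2 M.rot (by simp)
    have h2 : Commute M.inv g.1 := Subgroup.mem_centralizer_iff.1 g.2 M.inv (by simp)
    have hc : Commute (M.face ^ n) g.1 := Commute.zpow_left (h1.mul_left h2).inv_left n
    exact DFunLike.congr_fun hc.eq a)

theorem boundary_chainRep (p : ℕ) (M : OMap) (g : M.aut) :
    boundary p M ∘ₗ chainRep p M g =
      Finsupp.lmapDomain (ZMod p) (ZMod p) (autEdge g) ∘ₗ boundary p M := by
  ext d : 2
  simp [boundary, chainRep, Finsupp.mapDomain_sub, Finsupp.mapDomain_single, autEdge, ← aut_rot]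

/-- The homology module `H₁(S'; 𝔽_p)`, where `S'` is the surface of `M` punctured at the vertices
and face-centres, as a representation of `Aut⁺ M`: all 1-cycles, there being no 2-cells. -/
noncomputable def homologyRep (p : ℕ) (M : OMap) :
    Representation (ZMod p) M.aut (LinearMap.ker (boundary p M)) :=
  (chainRep p M).subrepresentation (LinearMap.ker (boundary p M)) (by
    intro g c hc
    have h := LinearMap.congr_fun (boundary_chainRep p M g) c
    rw [LinearMap.mem_ker] at hc
    simpa [hc] using h)

/-- The permutation module on the punctures: faces together with vertices. -/
noncomputable def punctureRep (p : ℕ) (M : OMap) :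
    Representation (ZMod p) M.aut (M.Face ⊕ M.Vertex →₀ ZMod p) where
  toFun g := Finsupp.lmapDomain (ZMod p) (ZMod p) (Sum.map (autFace g) (autVertex g))
  map_one' := by
    have h : Sum.map (autFace (1 : M.aut)) (autVertex (1 : M.aut)) = id := by
      funext x
      rcases x with ⟨⟨d⟩⟩ | ⟨⟨d⟩⟩ <;> rfl
    rw [h]
    exact Finsupp.lmapDomain_id _ _
  map_mul' a b := by
    have h : Sum.map (autFace (a * b)) (autVertex (a * b)) =
        Sum.map (autFace a) (autVertex a) ∘ Sum.map (autFace b) (autVertex b) := by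
      funext x
      rcases x with ⟨⟨d⟩⟩ | ⟨⟨d⟩⟩ <;> rfl
    rw [h]
    exact Finsupp.lmapDomain_comp _ _ _ _

instance (M : OMap) : Finite (M.Face ⊕ M.Vertex) := by
  have := M.finite_dart
  infer_instance

/-- The sum of all the punctures. -/
noncomputable def punctureSum (p : ℕ) (M : OMap) : M.Face ⊕ M.Vertex →₀ ZMod p :=
  Finsupp.equivFunOnFinite.symm (fun _ => 1)

theorem punctureRep_sum (p : ℕ) (M : OMap) (g : M.aut) :
    punctureRep p M g (punctureSum p M) = punctureSum p M := by
  have hinv : ∀ x, Sum.map (autFace g) (autVertex g)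
      (Sum.map (autFace g⁻¹) (autVertex g⁻¹) x) = x := by
    rintro (⟨⟨d⟩⟩ | ⟨⟨d⟩⟩)
    · exact congrArg (fun e => Sum.inl (⟦e⟧ : M.Face)) (g.1.apply_symm_apply d)
    · exact congrArg (fun e => Sum.inr (⟦e⟧ : M.Vertex)) (g.1.apply_symm_apply d)
  have hs : Function.Surjective (Sum.map (autFace g) (autVertex g)) := fun x => ⟨_, hinv x⟩
  have hi : Function.Injective (Sum.map (autFace g) (autVertex g)) :=
    Finite.injective_iff_surjective.2 hs
  ext x
  obtain ⟨y, rfl⟩ := hs x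
  exact (Finsupp.mapDomain_apply hi _ _).trans rfl

/-- The quotient of the permutation module on the punctures by the line spanned by their sum. -/
noncomputable def punctureQuotientRep (p : ℕ) (M : OMap) :
    Representation (ZMod p) M.aut
      ((M.Face ⊕ M.Vertex →₀ ZMod p) ⧸ Submodule.span (ZMod p) {punctureSum p M}) :=
  (punctureRep p M).quotient _ (by
    intro g
    rw [Submodule.span_singleton_le_iff_mem, Submodule.mem_comap, punctureRep_sum]
    exact Submodule.mem_span_singleton_self _)

end OMap

/-! ### The tetrahedron -/

namespace Tetra

/-- The position vectors of the four vertices of a regular tetrahedron centred at the origin. -/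
def pos : Fin 4 → Fin 3 → ℤ := ![![1, 1, 1], ![1, -1, -1], ![-1, 1, -1], ![-1, -1, 1]]

/-- `next i j` is the vertex that follows `j` in the anticlockwise order (seen from outside) of the
three vertices adjacent to `i`. -/
def next : Fin 4 → Fin 4 → Fin 4 := ![![0, 2, 3, 1], ![3, 1, 0, 2], ![1, 3, 2, 0], ![2, 0, 1, 3]]

/-- The dart `(i, j)` goes from the vertex `i` to the vertex `j`. -/
abbrev TDart : Type := {q : Fin 4 × Fin 4 // q.1 ≠ q.2}

def trot : Equiv.Perm TDart where
  toFun d := ⟨(d.1.1, next d.1.1 d.1.2), by revert d; decide⟩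
  invFun d := ⟨(d.1.1, next d.1.1 (next d.1.1 d.1.2)), by revert d; decide⟩
  left_inv := by decide
  right_inv := by decide

def tinv : Equiv.Perm TDart where
  toFun d := ⟨(d.1.2, d.1.1), d.2.symm⟩
  invFun d := ⟨(d.1.2, d.1.1), d.2.symm⟩
  left_inv _ := rfl
  right_inv _ := rfl

end Tetra

/-- The tetrahedral map `{3, 3}`. -/
def tetrahedron : OMap where
  Dart := Tetra.TDart
  finite_dart := inferInstance
  nonempty_dart := ⟨⟨(0, 1), by decide⟩⟩
  rot := Tetra.trot
  inv := Tetra.tinv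
  inv_inv _ := rfl
  inv_ne := by decide
  connected := by
    intro a b
    have h1 : Tetra.trot ∈ Subgroup.closure {Tetra.trot, Tetra.tinv} :=
      Subgroup.subset_closure (by simp)
    have h2 : Tetra.tinv ∈ Subgroup.closure {Tetra.trot, Tetra.tinv} :=
      Subgroup.subset_closure (by simp)
    have key : ∀ a b : Tetra.TDart, ∃ i j k : Fin 3, ∃ e : Fin 2,
        (Tetra.trot ^ (i : ℕ) * Tetra.tinv * Tetra.trot ^ (j : ℕ) * Tetra.tinv ^ (e : ℕ) *
          Tetra.trot ^ (k : ℕ)) a = b := by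
      decide
    obtain ⟨i, j, k, e, h⟩ := key a b
    exact ⟨_, mul_mem (mul_mem (mul_mem (mul_mem (pow_mem h1 _) h2) (pow_mem h1 _))
      (pow_mem h2 _)) (pow_mem h1 _), h⟩

namespace Tetra

/-- The action of `Aut⁺` of the tetrahedron on its four vertices. -/
def autVert (g : tetrahedron.aut) (i : Fin 4) : Fin 4 :=
  (g.1 (⟨(i, i + 1), by revert i; decide⟩ : TDart) : TDart).1.1

theorem autVert_eq (g : tetrahedron.aut) (d : TDart) : ((g.1 d : TDart)).1.1 = autVert g d.1.1 := by
  have hr : ∀ d : TDart, (g.1 (trot d) : TDart).1.1 = (g.1 d : TDart).1.1 := fun d =>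
    (congrArg (fun e : TDart => e.1.1) (OMap.aut_rot (M := tetrahedron) g d) :)
  have key : ∀ d : TDart, d = ⟨(d.1.1, d.1.1 + 1), by revert d; decide⟩ ∨
      d = trot ⟨(d.1.1, d.1.1 + 1), by revert d; decide⟩ ∨
      d = trot (trot ⟨(d.1.1, d.1.1 + 1), by revert d; decide⟩) := by decide
  unfold autVert
  rcases key d with h | h | h
  · exact congrArg (fun e : TDart => (g.1 e : TDart).1.1) h
  · exact (congrArg (fun e : TDart => (g.1 e : TDart).1.1) h).trans (hr _)
  · exact (congrArg (fun e : TDart => (g.1 e : TDart).1.1) h).trans ((hr _).trans (hr _))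

theorem autVert_one (i : Fin 4) : autVert 1 i = i := rfl

theorem autVert_mul (g h : tetrahedron.aut) (i : Fin 4) :
    autVert (g * h) i = autVert g (autVert h i) :=
  autVert_eq g _

theorem autVert_injective (g : tetrahedron.aut) : Function.Injective (autVert g) := by
  intro i j h
  have := congrArg (autVert g⁻¹) h
  rwa [← autVert_mul, ← autVert_mul, inv_mul_cancel, autVert_one, autVert_one] at this

/-- The matrix of the linear map of 3-space that takes the vertex `i` to the vertex `s i` of the
tetrahedron for each `i`. As `∑ i, pos i * (pos i)ᵀ = 4`, it is `1/4 ∑ i, pos (s i) * (pos i)ᵀ`; for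
a permutation `s` this is integral (a signed permutation matrix), so that the division is exact. -/
def symMatrix (s : Fin 4 → Fin 4) : Matrix (Fin 3) (Fin 3) ℤ :=
  Matrix.of fun a b => (∑ i, pos (s i) a * pos i b) / 4

theorem symMatrix_apply_pos : ∀ s : Equiv.Perm (Fin 4), ∀ i : Fin 4,
    (symMatrix s).mulVec (pos i) = pos (s i) := by decide

theorem eq_of_pos {A B : Matrix (Fin 3) (Fin 3) ℤ}
    (h : ∀ i, A.mulVec (pos i) = B.mulVec (pos i)) : A = B := by
  ext a b
  have h0 := congrFun (h 0) a
  have h1 := congrFun (h 1) a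
  have h2 := congrFun (h 2) a
  have h3 := congrFun (h 3) a
  simp [Matrix.mulVec, dotProduct, Fin.sum_univ_three, pos] at h0 h1 h2 h3
  fin_cases b <;> simp <;> linarith

/-- The natural representation `ρ₄` of `Aut⁺` of the tetrahedron as its rotation group, written in
integral matrices and reduced mod `p`. -/
def rho4 (p : ℕ) : Representation (ZMod p) tetrahedron.aut (Fin 3 → ZMod p) where
  toFun g := ((symMatrix (autVert g)).map (Int.castRingHom (ZMod p))).mulVecLin
  map_one' := by
    have h : symMatrix (autVert 1) = 1 := by
      apply eq_of_pos
      intro i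
      rw [Matrix.one_mulVec]
      exact symMatrix_apply_pos 1 i
    rw [h, Matrix.map_one _ (map_zero _) (map_one _), Matrix.mulVecLin_one]
    rfl
  map_mul' a b := by
    have happ : ∀ (g : tetrahedron.aut) (i : Fin 4),
        (symMatrix (autVert g)).mulVec (pos i) = pos (autVert g i) := fun g =>
      symMatrix_apply_pos
        (Equiv.ofBijective (autVert g) (Finite.injective_iff_bijective.1 (autVert_injective g)))
    have h : symMatrix (autVert (a * b)) = symMatrix (autVert a) * symMatrix (autVert b) := by
      apply eq_of_pos
      intro i
      rw [← Matrix.mulVec_mulVec, happ, happ, happ, autVert_mul]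
    rw [h, Matrix.map_mul, Matrix.mulVecLin_mul]
    rfl

/-- The principal representation `ρ₁`. -/
def rho1 (p : ℕ) : Representation (ZMod p) tetrahedron.aut (ZMod p) :=
  Representation.trivial (ZMod p) tetrahedron.aut (ZMod p)

end Tetra

/-! ### Rigidity of morphisms of maps. -/

namespace OMap

open Finsupp (linearCombination)

/-! The punctured surface retracts onto the medial graph, so its homology is the space of cycles
`ker (boundary p M)`. A cover with covering group `K` is given by voltages `ν : M.Dart → K` on the
corners (`Presentation`). Changing `ν` by a coboundary gives an equivalent cover, so only the
homomorphism `θ` induced on cycles matters (`Realizes`). Connectedness of the cover means that `θ`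
is surjective. For an orientably regular base, orientable regularity of the cover corresponds to
invariance of `ker θ` under `Aut⁺ M`, as this is the condition for automorphisms to lift. Thus
classes of covers correspond to proper invariant submodules of the homology, and the covering group
is the quotient module (`Realizes.cls_eq_iff`, `exists_of_surjective`, `Realizes.affords`).

For the tetrahedron, `modEquiv` gives coordinates on the homology: the cycle of `(t, u, v)` takes
the value `t + ⟨pos i, u⟩ + ⟨pos k, v⟩` at the corner of vertex `i` in the face opposite to `k`.
This is `ρ₁ ⊕ ρ₄ ⊕ ρ₄`. For odd `p` the Klein four-group splits it into a trivial line and three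
planes, and a rotation of order three identifies the planes (`mem_iff`). An invariant submodule is
therefore a pair consisting of a subspace of `𝔽_p` and a subspace of `𝔽_p²`. There are `2 * (p + 3)`
pairs, and leaving out the whole module gives `2p + 5` (`exists_kernel_eq`).

A vertex or face of the cover is longer than its image by the factor `addOrderOf (θ c)`, where `c`
is the loop about the puncture. Vertex loops have nonzero components in `ρ₁` and the first `ρ₄`,
face loops in `ρ₁` and the second `ρ₄`, so each kind is killed by exactly one of the quotients. This
gives the types, and counting cycles gives the genera. A reflection acts by the same coordinate
permutation on both copies of `ρ₄` and so fixes every invariant submodule, which gives regularity. A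
duality exchanges the two copies. -/

instance (M : OMap) : Finite M.Dart := M.finite_dart

instance (M : OMap) : Nonempty M.Dart := M.nonempty_dart

/-- A property of darts that is preserved by `rot` and `inv` holds everywhere if it holds once. -/
theorem dart_induction (M : OMap) {P : M.Dart → Prop} (hr : ∀ d, P d → P (M.rot d))
    (hi : ∀ d, P d → P (M.inv d)) {a : M.Dart} (ha : P a) (b : M.Dart) : P b := by
  obtain ⟨g, hg, rfl⟩ := M.connected a b
  have key : ∀ d, P d ↔ P (g d) := by
    refine Subgroup.closure_induction (p := fun g _ => ∀ d, P d ↔ P (g d)) ?_ ?_ ?_ ?_ hg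
    · rintro k (rfl | rfl) d
      · refine ⟨hr d, fun h => ?_⟩
        -- For the converse, `rot` has finite order on a finite set, so `d` is reached from `rot d`
        -- by further forward rotations.
        have hpow : ∀ n : ℕ, ∀ d, P d → P ((M.rot ^ n) d) := by
          intro n
          induction n with
          | zero => exact fun d h => h
          | succ n ih => exact fun d h => by rw [pow_succ, Equiv.Perm.mul_apply]; exact ih _ (hr d h)
        have h1 := hpow (orderOf M.rot - 1) _ h
        rwa [← Equiv.Perm.mul_apply, ← pow_succ, Nat.sub_add_cancel (orderOf_pos M.rot),
          pow_orderOf_eq_one] at h1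
      · exact ⟨hi d, fun h => by simpa [M.inv_inv] using hi _ h⟩
    · exact fun d => Iff.rfl
    · exact fun x y _ _ hx hy d => (hy d).trans (hx (y d))
    · intro x _ hx d
      have := hx (x⁻¹ d)
      rw [show x (x⁻¹ d) = d from x.apply_symm_apply d] at this
      exact this.symm
  exact (key a).1 ha

/-- The darts where two morphisms agree are closed under `rot` and `inv`, so connectedness makes one
point of agreement enough. In particular automorphisms act freely on darts. -/
theorem eq_of_eq_at {N M : OMap} {f g : N.Dart → M.Dart}
    (fr : ∀ d, f (N.rot d) = M.rot (f d)) (fi : ∀ d, f (N.inv d) = M.inv (f d))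
    (gr : ∀ d, g (N.rot d) = M.rot (g d)) (gi : ∀ d, g (N.inv d) = M.inv (g d))
    {a : N.Dart} (h : f a = g a) (b : N.Dart) : f b = g b :=
  N.dart_induction (P := fun d => f d = g d) (fun d hd => by rw [fr, gr, hd])
    (fun d hd => by rw [fi, gi, hd]) h b

theorem aut_ext {M : OMap} {g h : M.aut} {a : M.Dart} (H : g.1 a = h.1 a) : g = h :=
  Subtype.ext <| Equiv.ext <|
    eq_of_eq_at (aut_rot g) (aut_inv g) (aut_rot h) (aut_inv h) H

/-- An automorphism as an isomorphism. -/
def autIso {M : OMap} (g : M.aut) : M.Iso M := ⟨g.1, aut_rot g, aut_inv g⟩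

/-- An isomorphism from a map to itself as an automorphism. -/
def Iso.toAut {M : OMap} (φ : M.Iso M) : M.aut :=
  ⟨φ.toEquiv, Subgroup.mem_centralizer_iff.2 (by
    rintro k (rfl | rfl)
    · exact Equiv.ext fun d => (φ.map_rot d).symm
    · exact Equiv.ext fun d => (φ.map_inv d).symm)⟩

theorem edge_inv (M : OMap) (d : M.Dart) : (⟦M.inv d⟧ : M.Edge) = ⟦d⟧ :=
  Quotient.sound (Equiv.Perm.sameCycle_apply_left.2 (Equiv.Perm.SameCycle.refl _ _))

theorem edge_eq {M : OMap} {d d' : M.Dart} (h : (⟦d⟧ : M.Edge) = ⟦d'⟧) :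
    d' = d ∨ d' = M.inv d := by
  obtain ⟨n, rfl⟩ := Quotient.exact h
  have h2 : M.inv ^ (2 : ℤ) = 1 := Equiv.ext fun d => M.inv_inv d
  rcases Int.even_or_odd' n with ⟨m, rfl | rfl⟩
  · left; rw [zpow_mul, h2, one_zpow]; rfl
  · right; rw [zpow_add, zpow_mul, h2, one_zpow, one_mul, zpow_one]

/-! ### Voltage assignments, cycles and coverings. -/

section Voltage

variable {p : ℕ} [Fact p.Prime] {M M' N N' : OMap} {K K' : Type} [AddCommGroup K]
  [Module (ZMod p) K] [AddCommGroup K'] [Module (ZMod p) K']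

theorem boundary_single (d : M.Dart) : boundary p M (Finsupp.single d 1) =
    Finsupp.single (⟦M.rot d⟧ : M.Edge) 1 - Finsupp.single (⟦d⟧ : M.Edge) 1 := by
  simp [boundary, Finsupp.mapDomain_single]

/-- Coboundaries vanish on cycles. -/
theorem coboundary_eq_zero {ν b : M.Dart → K} (hb : ∀ d, b (M.inv d) = b d)
    (h : ∀ d, ν d = b (M.rot d) - b d) {c : M.Dart →₀ ZMod p}
    (hc : c ∈ LinearMap.ker (boundary p M)) : linearCombination (ZMod p) ν c = 0 := by
  let b' : M.Edge → K := Quotient.lift b (by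
    intro x y hxy
    rcases edge_eq (Quotient.sound hxy) with rfl | rfl
    · rfl
    · exact (hb x).symm)
  have : linearCombination (ZMod p) ν = linearCombination (ZMod p) b' ∘ₗ boundary p M := by
    ext d
    simp only [LinearMap.comp_apply, Finsupp.lsingle_apply]
    rw [boundary_single, map_sub]
    simp [h, b']
  rw [this, LinearMap.comp_apply, LinearMap.mem_ker.1 hc, map_zero]

/-- A cochain that vanishes on all cycles is a coboundary. -/
theorem exists_coboundary (φ : (M.Dart →₀ ZMod p) →ₗ[ZMod p] K)
    (h : ∀ c ∈ LinearMap.ker (boundary p M), φ c = 0) :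
    ∃ b : M.Dart → K, (∀ d, b (M.inv d) = b d) ∧
      ∀ d, φ (Finsupp.single d 1) = b (M.rot d) - b d := by
  -- By `h`, `φ` factors through the image of `boundary`; over a field the factor extends to all
  -- 0-chains, and `b` is its value on the edge of a dart.
  obtain ⟨ψ, hψ⟩ := LinearMap.exists_extend
    (((LinearMap.ker (boundary p M)).liftQ φ (fun c hc => LinearMap.mem_ker.2 (h c hc))) ∘ₗ
      (boundary p M).quotKerEquivRange.symm.toLinearMap)
  have key : ∀ c, ψ (boundary p M c) = φ c := by
    intro c
    have := LinearMap.congr_fun hψ ⟨boundary p M c, LinearMap.mem_range_self _ c⟩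
    simp only [LinearMap.comp_apply, Submodule.subtype_apply, LinearEquiv.coe_coe] at this
    rw [this]
    have h2 : (boundary p M).quotKerEquivRange.symm ⟨boundary p M c, LinearMap.mem_range_self _ c⟩
        = Submodule.Quotient.mk c := by
      rw [LinearEquiv.symm_apply_eq]; rfl
    rw [h2, Submodule.liftQ_apply]
  refine ⟨fun d => ψ (Finsupp.single ⟦d⟧ 1), fun d => ?_, fun d => ?_⟩
  · exact congrArg (fun q => ψ (Finsupp.single q 1)) (edge_inv M d)
  · rw [← key, boundary_single, map_sub]

/-- A description of the map `N` as a cover of `M` with voltages `ν`. -/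
structure Presentation (N M : OMap) {K : Type} [AddCommGroup K] (ν : M.Dart → K) where
  e : M.Dart × K ≃ N.Dart
  rot : ∀ d k, N.rot (e (d, k)) = e (M.rot d, k + ν d)
  inv : ∀ d k, N.inv (e (d, k)) = e (M.inv d, k)

namespace Presentation

variable {ν : M.Dart → K} {ν' : M'.Dart → K'}

/-- Translation by an element of the voltage group. -/
def trans (P : Presentation N M ν) (x : K) : N.aut :=
  Iso.toAut
    { toEquiv := P.e.symm.trans (((Equiv.refl _).prodCongr (Equiv.addRight x)).trans P.e)
      map_rot := by
        intro n
        obtain ⟨⟨d, k⟩, rfl⟩ := P.e.surjective n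
        simp [P.rot, add_right_comm]
      map_inv := by
        intro n
        obtain ⟨⟨d, k⟩, rfl⟩ := P.e.surjective n
        simp [P.inv] }

theorem trans_apply (P : Presentation N M ν) (x : K) (d : M.Dart) (k : K) :
    (P.trans x).1 (P.e (d, k)) = P.e (d, k + x) := by
  simp [trans, Iso.toAut]

theorem trans_mul (P : Presentation N M ν) (x y : K) : P.trans x * P.trans y = P.trans (x + y) := by
  obtain ⟨d⟩ := M.nonempty_dart
  refine aut_ext (a := P.e (d, 0)) ?_
  change (P.trans x).1 ((P.trans y).1 _) = _
  rw [P.trans_apply, P.trans_apply, P.trans_apply, add_assoc, add_comm x]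

theorem trans_zero (P : Presentation N M ν) : P.trans 0 = 1 := by
  obtain ⟨d⟩ := M.nonempty_dart
  refine aut_ext (a := P.e (d, 0)) ?_
  rw [P.trans_apply, add_zero]
  rfl

theorem trans_injective (P : Presentation N M ν) : Function.Injective P.trans := by
  intro x y h
  obtain ⟨d⟩ := M.nonempty_dart
  have := P.trans_apply x d 0
  rw [h, P.trans_apply] at this
  have := (Prod.ext_iff.1 (P.e.injective this)).2
  simp only [zero_add] at this
  exact this.symm

/-- The voltages of the cycles generate the voltage group of a connected cover. -/
theorem surjective (P : Presentation N M ν) (k : K) :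
    ∃ c ∈ LinearMap.ker (boundary p M), linearCombination (ZMod p) ν c = k := by
  let L := (LinearMap.ker (boundary p M)).map (linearCombination (ZMod p) ν)
  obtain ⟨b, hb, hν⟩ := exists_coboundary (L.mkQ ∘ₗ linearCombination (ZMod p) ν) (by
    intro c hc
    rw [LinearMap.comp_apply, Submodule.mkQ_apply, Submodule.Quotient.mk_eq_zero]
    exact ⟨c, hc, rfl⟩)
  obtain ⟨d0⟩ := M.nonempty_dart
  -- Modulo the span `L` of the cycle voltages, `ν` is the coboundary of `b`. Hence level minus `b`
  -- is invariant under `rot` and `inv`, so constant on the connected map `N`; comparing `(d0, k)`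
  -- with `(d0, 0)` puts `k` in `L`.
  let F : N.Dart → K ⧸ L := fun n => L.mkQ (P.e.symm n).2 - b (P.e.symm n).1
  have hF : ∀ n, F n = F (P.e (d0, 0)) := by
    refine N.dart_induction (P := fun n => F n = F (P.e (d0, 0))) ?_ ?_ rfl
    · intro n
      obtain ⟨⟨d, k⟩, rfl⟩ := P.e.surjective n
      intro h
      rw [← h]
      have := hν d
      simp only [LinearMap.comp_apply, Finsupp.linearCombination_single, one_smul] at this
      simp only [F, P.rot, Equiv.symm_apply_apply, map_add, this]
      abel
    · intro n
      obtain ⟨⟨d, k⟩, rfl⟩ := P.e.surjective n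
      intro h
      rw [← h]
      simp only [F, P.inv, Equiv.symm_apply_apply, hb]
  have := hF (P.e (d0, k))
  simp only [F, Equiv.symm_apply_apply, map_zero, sub_left_inj] at this
  rw [Submodule.mkQ_apply, Submodule.Quotient.mk_eq_zero] at this
  exact this

/-- Isomorphisms of the base lift if the voltages of cycles are compatible. -/
theorem exists_iso (P : Presentation N M ν) (P' : Presentation N' M' ν') (g : M.Iso M')
    (τ : K ≃ₗ[ZMod p] K')
    (h : ∀ c ∈ LinearMap.ker (boundary p M),
      linearCombination (ZMod p) (fun d => ν' (g.toEquiv d)) c =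
        τ (linearCombination (ZMod p) ν c)) (d0 : M.Dart) (k0 : K') :
    ∃ φ : N.Iso N', ∃ b : M.Dart → K',
      (∀ d k, φ.toEquiv (P.e (d, k)) = P'.e (g.toEquiv d, b d + τ k)) ∧ b d0 = k0 := by
  obtain ⟨b, hb, hν⟩ := exists_coboundary
    (linearCombination (ZMod p) (fun d => ν' (g.toEquiv d)) - τ.toLinearMap ∘ₗ
      linearCombination (ZMod p) ν) (by
    intro c hc
    simp [h c hc])
  simp only [LinearMap.sub_apply, LinearMap.comp_apply, Finsupp.linearCombination_single, one_smul,
    LinearEquiv.coe_coe] at hν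
  -- The two voltage assignments differ by the coboundary of `b`, which is the correction needed on
  -- each fibre. Shifting `b` by the constant `k0 - b d0` leaves its coboundary alone and prescribes
  -- the value at `d0`.
  let ψ : M.Dart × K ≃ M'.Dart × K' :=
    { toFun := fun x => (g.toEquiv x.1, b x.1 - b d0 + k0 + τ x.2)
      invFun := fun y => (g.toEquiv.symm y.1,
        τ.symm (y.2 - (b (g.toEquiv.symm y.1) - b d0 + k0)))
      left_inv := by rintro ⟨d, k⟩; simp
      right_inv := by rintro ⟨d, k⟩; simp }
  have hψ : ∀ d k, (P.e.symm.trans (ψ.trans P'.e)) (P.e (d, k)) =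
      P'.e (g.toEquiv d, (b d - b d0 + k0) + τ k) := by
    intro d k; simp [ψ]
  refine ⟨⟨P.e.symm.trans (ψ.trans P'.e), ?_, ?_⟩, fun d => b d - b d0 + k0, hψ, by simp⟩
  · intro n
    obtain ⟨⟨d, k⟩, rfl⟩ := P.e.surjective n
    rw [P.rot, hψ, hψ, P'.rot, g.map_rot, map_add]
    congr 2
    rw [← sub_eq_zero]
    have := hν d
    rw [sub_eq_iff_eq_add] at this
    rw [this]
    abel
  · intro n
    obtain ⟨⟨d, k⟩, rfl⟩ := P.e.surjective n
    rw [P.inv, hψ, hψ, P'.inv, g.map_inv, hb]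

/-- Isomorphisms between voltage covers that lie over an isomorphism of the base. -/
theorem exists_linearEquiv (P : Presentation N M ν) (P' : Presentation N' M' ν') (g : M.Iso M')
    (φ : N.Iso N') (hφ : ∀ d k, (P'.e.symm (φ.toEquiv (P.e (d, k)))).1 = g.toEquiv d) :
    ∃ τ : K ≃ₗ[ZMod p] K', ∃ b : M.Dart → K',
      (∀ d k, φ.toEquiv (P.e (d, k)) = P'.e (g.toEquiv d, b d + τ k)) ∧
      ∀ c ∈ LinearMap.ker (boundary p M),
        linearCombination (ZMod p) (fun d => ν' (g.toEquiv d)) c =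
          τ (linearCombination (ZMod p) ν c) := by
  obtain ⟨d0⟩ := M.nonempty_dart
  let f : M.Dart → K → K' := fun d k => (P'.e.symm (φ.toEquiv (P.e (d, k)))).2
  have hf : ∀ d k, φ.toEquiv (P.e (d, k)) = P'.e (g.toEquiv d, f d k) := by
    intro d k
    rw [← Equiv.symm_apply_eq]
    exact Prod.ext (hφ d k) rfl
  let x : K → K' := fun a => f d0 a - f d0 0
  -- Translating by `a` before `φ` and by `x a` after it are morphisms that agree at one dart, so
  -- they coincide. This makes `x` additive and independent of the fibre.
  have hx : ∀ d k a, f d (k + a) = f d k + x a := by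
    intro d k a
    have := eq_of_eq_at (N := N) (M := N') (f := fun n => φ.toEquiv ((P.trans a).1 n))
      (g := fun n => (P'.trans (x a)).1 (φ.toEquiv n))
      (fun n => by rw [aut_rot, φ.map_rot]) (fun n => by rw [aut_inv, φ.map_inv])
      (fun n => by rw [φ.map_rot, aut_rot]) (fun n => by rw [φ.map_inv, aut_inv])
      (a := P.e (d0, 0)) (by simp only [trans_apply, hf, x]; simp) (P.e (d, k))
    simp only [trans_apply, hf] at this
    exact (Prod.ext_iff.1 (P'.e.injective this)).2
  let X : K →+ K' := AddMonoidHom.mk' x (fun a b => by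
    have := hx d0 a b
    simp only [x] at this ⊢
    rw [this]; abel)
  have hX : Function.Bijective (X.toZModLinearMap p) := by
    constructor
    · intro a b hab
      have hab : f d0 a - f d0 0 = f d0 b - f d0 0 := hab
      have := (hf d0 a).trans ((congrArg (fun y => P'.e (g.toEquiv d0, y))
        (sub_left_inj.1 hab)).trans (hf d0 b).symm)
      exact (Prod.ext_iff.1 (P.e.injective (φ.toEquiv.injective this))).2
    · intro y
      obtain ⟨n, hn⟩ := φ.toEquiv.surjective (P'.e (g.toEquiv d0, f d0 0 + y))
      obtain ⟨⟨d, k⟩, rfl⟩ := P.e.surjective n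
      rw [hf] at hn
      have h2 := Prod.ext_iff.1 (P'.e.injective hn)
      obtain rfl := g.toEquiv.injective h2.1
      refine ⟨k, ?_⟩
      change f d k - f d 0 = y
      rw [sub_eq_iff_eq_add, add_comm]
      exact h2.2
  let τ := LinearEquiv.ofBijective (X.toZModLinearMap p) hX
  have hτ : ∀ k, τ k = x k := fun _ => rfl
  have hb : ∀ d k, f d k = f d 0 + τ k := fun d k => by rw [hτ, ← hx, zero_add]
  refine ⟨τ, fun d => f d 0, fun d k => by rw [hf, hb], fun c hc => ?_⟩
  have hinv : ∀ d, f (M.inv d) 0 = f d 0 := by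
    intro d
    have := φ.map_inv (P.e (d, 0))
    rw [P.inv, hf, hf, P'.inv] at this
    exact (Prod.ext_iff.1 (P'.e.injective this)).2
  -- Compatibility of `φ` with `rot` says that the two voltages differ by a coboundary, which
  -- vanishes on cycles.
  have hrot : ∀ d, ν' (g.toEquiv d) - τ (ν d) = f (M.rot d) 0 - f d 0 := by
    intro d
    have := φ.map_rot (P.e (d, 0))
    rw [P.rot, hf, hf, P'.rot, zero_add] at this
    have := (Prod.ext_iff.1 (P'.e.injective this)).2
    simp only at this
    rw [hb] at this
    rw [sub_eq_sub_iff_add_eq_add, add_comm, ← this, add_comm]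
  have := coboundary_eq_zero (p := p) (b := fun d => f d 0)
    (ν := fun d => ν' (g.toEquiv d) - τ (ν d)) hinv hrot hc
  rw [← sub_eq_zero, ← this]
  have : linearCombination (ZMod p) (fun d => ν' (g.toEquiv d) - τ (ν d)) =
    linearCombination (ZMod p) (fun d => ν' (g.toEquiv d)) - τ.toLinearMap ∘ₗ
      linearCombination (ZMod p) ν := by
    ext d; simp
  rw [this]; rfl

/-- Changing the voltage group. -/
def map (P : Presentation N M ν) (τ : K ≃+ K') : Presentation N M (fun d => τ (ν d)) where
  e := ((Equiv.refl _).prodCongr τ.symm.toEquiv).trans P.e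
  rot d k := by simp [P.rot]
  inv d k := by simp [P.inv]

theorem rot_symm (P : Presentation N M ν) (d : M.Dart) (k : K) :
    N.rot⁻¹ (P.e (d, k)) = P.e (M.rot⁻¹ d, k + -ν (M.rot⁻¹ d)) := by
  rw [Equiv.Perm.inv_eq_iff_eq, P.rot]
  simp

theorem face (P : Presentation N M ν) (d : M.Dart) (k : K) :
    N.face (P.e (d, k)) = P.e (M.face d, k + -ν (M.rot⁻¹ d)) := by
  have h : M.rot (M.inv (M.face d)) = d := (M.rot * M.inv).apply_symm_apply d
  have h' : M.inv (M.face d) = M.rot⁻¹ d := by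
    rw [Equiv.Perm.eq_inv_iff_eq]; exact h
  rw [OMap.face, Equiv.Perm.inv_eq_iff_eq, Equiv.Perm.mul_apply, P.inv, P.rot, h, h']
  simp

/-- The mirror image of a voltage cover. -/
def mirror (P : Presentation N M ν) :
    Presentation N.mirror M.mirror (fun d : M.Dart => -ν (M.rot⁻¹ d)) :=
  ⟨P.e, P.rot_symm, P.inv⟩

/-- The dual of a voltage cover. -/
def dual (P : Presentation N M ν) :
    Presentation N.dual M.dual (fun d : M.Dart => -ν (M.rot⁻¹ d)) :=
  ⟨P.e, P.face, P.inv⟩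

end Presentation

/-- If the voltages of the cycles generate the voltage group, then the cover is connected. -/
theorem voltage_connected {ν : M.Dart → K}
    (hν : ∀ k, ∃ c ∈ LinearMap.ker (boundary p M), linearCombination (ZMod p) ν c = k)
    (r i : Equiv.Perm (M.Dart × K)) (hr : ∀ d k, r (d, k) = (M.rot d, k + ν d))
    (hi : ∀ d k, i (d, k) = (M.inv d, k)) (a b : M.Dart × K) :
    ∃ g ∈ Subgroup.closure {r, i}, g a = b := by
  let H := Subgroup.closure {r, i}
  let R : M.Dart × K → M.Dart × K → Prop := fun a b => ∃ g ∈ H, g a = b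
  have hrR : ∀ d k, R (d, k) (M.rot d, k + ν d) := fun d k =>
    ⟨r, Subgroup.subset_closure (by simp), hr d k⟩
  have hiR : ∀ d k, R (d, k) (M.inv d, k) := fun d k =>
    ⟨i, Subgroup.subset_closure (by simp), hi d k⟩
  have symm : ∀ {a b}, R a b → R b a := by
    rintro a b ⟨g, hg, rfl⟩
    exact ⟨g⁻¹, inv_mem hg, by simp⟩
  have tr : ∀ {a b c}, R a b → R b c → R a c := by
    rintro a b c ⟨g, hg, rfl⟩ ⟨h, hh, rfl⟩
    exact ⟨h * g, mul_mem hh hg, rfl⟩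
  let T : K → Equiv.Perm (M.Dart × K) := fun x => (Equiv.refl _).prodCongr (Equiv.addRight x)
  have hT : ∀ x, ∀ g ∈ H, Commute g (T x) := by
    intro x g hg
    have : H ≤ Subgroup.centralizer {T x} := by
      refine (Subgroup.closure_le _).2 ?_
      rintro k (rfl | rfl)
      · refine Subgroup.mem_centralizer_iff.2 fun h hh => ?_
        rw [Set.mem_singleton_iff.1 hh]
        ext1 ⟨d, y⟩
        simp [T, hr, add_right_comm]
      · refine Subgroup.mem_centralizer_iff.2 fun h hh => ?_
        rw [Set.mem_singleton_iff.1 hh]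
        ext1 ⟨d, y⟩
        simp [T, hi]
    exact (Subgroup.mem_centralizer_iff.1 (this hg) _ rfl).symm
  have shift : ∀ {d k d' k'} (x : K), R (d, k) (d', k') → R (d, k + x) (d', k' + x) := by
    rintro d k d' k' x ⟨g, hg, h⟩
    refine ⟨g, hg, ?_⟩
    have := DFunLike.congr_fun (hT x g hg).eq (d, k)
    simp only [Equiv.Perm.mul_apply, h] at this
    exact this
  obtain ⟨d0⟩ := M.nonempty_dart
  -- The levels over `d0` reachable from level `0`. They form a subgroup because translations
  -- commute with `r` and `i`, and an additive subgroup is a `ZMod p`-subspace.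
  let L : Submodule (ZMod p) K := AddSubgroup.toZModSubmodule p
    { carrier := {x | R (d0, 0) (d0, x)}
      zero_mem' := ⟨1, one_mem _, rfl⟩
      add_mem' := by
        intro x y hx hy
        have := shift y hx
        rw [zero_add] at this
        exact tr hy this
      neg_mem' := by
        intro x hx
        have := shift (-x) (symm hx)
        simpa using this }
  have hL : ∀ {x}, x ∈ L ↔ R (d0, 0) (d0, x) := Iff.rfl
  have h1 : ∀ d, ∃ k, R (d0, 0) (d, k) :=
    M.dart_induction (fun d ⟨k, hk⟩ => ⟨_, tr hk (hrR d k)⟩)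
      (fun d ⟨k, hk⟩ => ⟨_, tr hk (hiR d k)⟩) ⟨0, ⟨1, one_mem _, rfl⟩⟩
  -- Since `i` does not change the level, a reachable level can be chosen per edge rather than per
  -- dart. It serves as a potential whose coboundary is `ν` modulo `L`, so all cycle voltages lie in
  -- `L`.
  have h2 : ∀ q : M.Edge, ∃ k, ∀ d, (⟦d⟧ : M.Edge) = q → R (d0, 0) (d, k) := by
    intro q
    induction q using Quotient.inductionOn with | _ d
    obtain ⟨k, hk⟩ := h1 d
    refine ⟨k, fun d' h => ?_⟩
    rcases edge_eq h.symm with rfl | rfl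
    · exact hk
    · exact tr hk (hiR d k)
  choose a' ha using h2
  have diff : ∀ {d x y}, R (d0, 0) (d, x) → R (d0, 0) (d, y) → y - x ∈ L := by
    intro d x y hx hy
    have := shift (y - x) (symm hx)
    rw [zero_add, add_sub_cancel] at this
    exact hL.2 (tr hy this)
  have hcob : ∀ d, L.mkQ (ν d) = L.mkQ (a' ⟦M.rot d⟧) - L.mkQ (a' ⟦d⟧) := by
    intro d
    rw [← sub_eq_zero, ← map_sub, ← map_sub, Submodule.mkQ_apply, Submodule.Quotient.mk_eq_zero]
    have := diff (ha _ (M.rot d) rfl) (tr (ha _ d rfl) (hrR _ _))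
    convert this using 1
    abel
  have htop : ∀ k, k ∈ L := by
    intro k
    obtain ⟨c, hc, rfl⟩ := hν k
    have := coboundary_eq_zero (p := p) (ν := fun d => L.mkQ (ν d)) (b := fun d => L.mkQ (a' ⟦d⟧))
      (fun d => by rw [edge_inv]) hcob hc
    rw [← Submodule.Quotient.mk_eq_zero, ← Submodule.mkQ_apply, ← this]
    have h3 : linearCombination (ZMod p) (fun d => L.mkQ (ν d)) =
        L.mkQ ∘ₗ linearCombination (ZMod p) ν := by ext d; simp
    rw [h3]; rfl
  have hall : ∀ z, R (d0, 0) z := by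
    rintro ⟨d, k⟩
    obtain ⟨x, hx⟩ := h1 d
    have := shift (k - x) hx
    rw [zero_add, add_sub_cancel] at this
    exact tr (htop _) this
  exact tr (symm (hall a)) (hall b)

/-- The cover of `M` with voltages `ν`. -/
def voltageMap [Finite K] (ν : M.Dart → K)
    (hν : ∀ k, ∃ c ∈ LinearMap.ker (boundary p M), linearCombination (ZMod p) ν c = k) : OMap where
  Dart := M.Dart × K
  finite_dart := inferInstance
  nonempty_dart := inferInstance
  rot :=
    { toFun := fun x => (M.rot x.1, x.2 + ν x.1)
      invFun := fun x => (M.rot⁻¹ x.1, x.2 - ν (M.rot⁻¹ x.1))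
      left_inv := by rintro ⟨d, k⟩; simp
      right_inv := by rintro ⟨d, k⟩; simp }
  inv :=
    { toFun := fun x => (M.inv x.1, x.2)
      invFun := fun x => (M.inv x.1, x.2)
      left_inv := by rintro ⟨d, k⟩; simp [M.inv_inv]
      right_inv := by rintro ⟨d, k⟩; simp [M.inv_inv] }
  inv_inv := by rintro ⟨d, k⟩; simp [M.inv_inv]
  inv_ne := by rintro ⟨d, k⟩ h; exact M.inv_ne d (Prod.ext_iff.1 h).1
  connected := voltage_connected hν _ _ (fun _ _ => rfl) (fun _ _ => rfl)

def voltageMapPresentation [Finite K] (ν : M.Dart → K)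
    (hν : ∀ k, ∃ c ∈ LinearMap.ker (boundary p M), linearCombination (ZMod p) ν c = k) :
    Presentation (voltageMap ν hν) M ν :=
  ⟨Equiv.refl _, fun _ _ => rfl, fun _ _ => rfl⟩

end Voltage

end OMap

/-! ### Lengths and numbers of cycles. -/

namespace OMap

open Finsupp (linearCombination)

section Period

open Function

/-- The periods of a permutation of `D × K` that lifts `f` by means of the voltages `μ`. -/
theorem minimalPeriod_voltage {X D K : Type*} [AddCommGroup K] (e : D × K ≃ X) {σ : X → X}
    {f : D → D} {μ : D → K} (h : ∀ d k, σ (e (d, k)) = e (f d, k + μ d)) (d : D) (k : K)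
    (hpos : 0 < minimalPeriod f d) :
    minimalPeriod σ (e (d, k)) =
      minimalPeriod f d * addOrderOf (∑ i ∈ Finset.range (minimalPeriod f d), μ (f^[i] d)) := by
  have hit : ∀ n, σ^[n] (e (d, k)) = e (f^[n] d, k + ∑ i ∈ Finset.range n, μ (f^[i] d)) := by
    intro n
    induction n with
    | zero => simp
    | succ n ih =>
      rw [iterate_succ_apply', ih, h, ← iterate_succ_apply' f, Finset.sum_range_succ, add_assoc]
  set m := minimalPeriod f d with hm
  have hsum : ∀ j, ∑ i ∈ Finset.range (m * j), μ (f^[i] d) =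
      j • ∑ i ∈ Finset.range m, μ (f^[i] d) := by
    intro j
    induction j with
    | zero => simp
    | succ j ih =>
      rw [Nat.mul_succ, Finset.sum_range_add, ih, succ_nsmul]
      congr 1
      refine Finset.sum_congr rfl fun i _ => ?_
      rw [add_comm, iterate_add_apply]
      congr 2
      exact ((isPeriodicPt_minimalPeriod f d).mul_const j)
  -- Both sides are compared through their multiples: `n` is a period upstairs iff `n = m * j` and
  -- `j` kills the total voltage once round the cycle.
  refine Nat.dvd_right_iff_eq.1 fun n => ?_
  rw [← isPeriodicPt_iff_minimalPeriod_dvd, IsPeriodicPt, IsFixedPt, hit, e.apply_eq_iff_eq,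
    Prod.mk_inj, add_eq_left]
  constructor
  · rintro ⟨h1, h2⟩
    obtain ⟨j, rfl⟩ := isPeriodicPt_iff_minimalPeriod_dvd.1 h1
    rw [hsum] at h2
    exact mul_dvd_mul_left _ (addOrderOf_dvd_of_nsmul_eq_zero h2)
  · intro h1
    obtain ⟨j, rfl⟩ := (dvd_mul_right _ _).trans h1
    refine ⟨(isPeriodicPt_minimalPeriod f d).mul_const j, ?_⟩
    rw [hsum]
    exact addOrderOf_dvd_iff_nsmul_eq_zero.1 (Nat.dvd_of_mul_dvd_mul_left hpos h1)

/-- A cycle is an orbit of the cyclic group generated by `σ`, whose size is the minimal period.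
Applied to `rot`, `inv` and `face`, this counts vertices, edges and faces. -/
theorem card_cycles_mul {X : Type*} [Finite X] (σ : Equiv.Perm X) {m : ℕ}
    (h : ∀ d, minimalPeriod σ d = m) :
    Nat.card (Quotient (Equiv.Perm.SameCycle.setoid σ)) * m = Nat.card X := by
  have := Fintype.ofFinite (Quotient (Equiv.Perm.SameCycle.setoid σ))
  have e := Equiv.sigmaFiberEquiv (fun d : X => (⟦d⟧ : Quotient (Equiv.Perm.SameCycle.setoid σ)))
  rw [← Nat.card_congr e, Nat.card_sigma]
  have : ∀ q : Quotient (Equiv.Perm.SameCycle.setoid σ), Nat.card {d : X // ⟦d⟧ = q} = m := by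
    intro q
    induction q using Quotient.inductionOn with | _ x
    have : {d : X | (⟦d⟧ : Quotient (Equiv.Perm.SameCycle.setoid σ)) = ⟦x⟧} =
        MulAction.orbit (Subgroup.zpowers σ) x := by
      ext d
      rw [Set.mem_ofPred_eq]
      constructor
      · intro hd
        obtain ⟨n, hn⟩ := Quotient.exact hd.symm
        exact ⟨⟨σ ^ n, n, rfl⟩, hn⟩
      · rintro ⟨⟨_, n, rfl⟩, hn⟩
        exact (Quotient.sound ⟨n, hn⟩ : (⟦x⟧ : Quotient (Equiv.Perm.SameCycle.setoid σ)) = ⟦d⟧).symm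
    change Nat.card {d : X | (⟦d⟧ : Quotient (Equiv.Perm.SameCycle.setoid σ)) = ⟦x⟧} = m
    rw [this]
    have := Fintype.ofFinite (MulAction.orbit (Subgroup.zpowers σ) x)
    rw [Nat.card_eq_fintype_card, ← MulAction.minimalPeriod_eq_card]
    exact h x
  simp only [this]
  simp [Nat.card_eq_fintype_card]

end Period

/-! ### Elementary abelian covers as equivariant quotients of the homology. -/

section Rep

variable {p : ℕ} [Fact p.Prime] {M : OMap} {K : Type} [AddCommGroup K] [Module (ZMod p) K]

theorem coe_homologyRep (g : M.aut) (c : LinearMap.ker (boundary p M)) :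
    (homologyRep p M g c : M.Dart →₀ ZMod p) = Finsupp.mapDomain g.1 c.1 := rfl

theorem linearCombination_homologyRep (ν : M.Dart → K) (g : M.aut)
    (c : LinearMap.ker (boundary p M)) :
    linearCombination (ZMod p) ν (homologyRep p M g c : M.Dart →₀ ZMod p) =
      linearCombination (ZMod p) (fun d => ν (g.1 d)) c.1 := by
  rw [coe_homologyRep, Finsupp.linearCombination_mapDomain]
  rfl

end Rep

/-- Both targets are the quotient of `V` by the common kernel. -/
theorem exists_linearEquiv_of_ker_eq {k V W W' : Type*} [Field k] [AddCommGroup V] [Module k V]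
    [AddCommGroup W] [Module k W] [AddCommGroup W'] [Module k W'] {f : V →ₗ[k] W} {f' : V →ₗ[k] W'}
    (hf : Function.Surjective f) (hf' : Function.Surjective f')
    (h : LinearMap.ker f = LinearMap.ker f') : ∃ τ : W ≃ₗ[k] W', ∀ v, f' v = τ (f v) := by
  refine ⟨(f.quotKerEquivOfSurjective hf).symm ≪≫ₗ Submodule.quotEquivOfEq _ _ h ≪≫ₗ
    f'.quotKerEquivOfSurjective hf', fun v => ?_⟩
  have : (f.quotKerEquivOfSurjective hf).symm (f v) = Submodule.Quotient.mk v := by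
    rw [LinearEquiv.symm_apply_eq]; rfl
  simp only [LinearEquiv.trans_apply, this]
  rfl

namespace ElemAbCover

variable {p : ℕ} [Fact p.Prime] {M : OMap} {K K' : Type} [AddCommGroup K] [Module (ZMod p) K]
  [AddCommGroup K'] [Module (ZMod p) K']

/-- The cover `N` corresponds to the homomorphism `θ` from the homology of the punctured surface
to the covering group. -/
def Realizes (N : ElemAbCover p M) (θ : LinearMap.ker (boundary p M) →ₗ[ZMod p] K) : Prop :=
  ∃ (ν : M.Dart → K) (P : Presentation N.total M ν), (∀ d k, N.proj.toFun (P.e (d, k)) = d) ∧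
    ∀ c : LinearMap.ker (boundary p M), linearCombination (ZMod p) ν c = θ c

theorem proj_surjective (N : ElemAbCover p M) : Function.Surjective N.proj.toFun := by
  obtain ⟨n⟩ := N.total.nonempty_dart
  exact fun d => M.dart_induction (P := fun d => ∃ n, N.proj.toFun n = d)
    (fun d ⟨n, hn⟩ => ⟨N.total.rot n, by rw [N.proj.map_rot, hn]⟩)
    (fun d ⟨n, hn⟩ => ⟨N.total.inv n, by rw [N.proj.map_inv, hn]⟩) ⟨n, rfl⟩ d

/-- A section of the covering that commutes with `inv`. -/
theorem exists_section (N : ElemAbCover p M) : ∃ s : M.Dart → N.total.Dart,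
    (∀ d, N.proj.toFun (s d) = d) ∧ ∀ d, s (M.inv d) = N.total.inv (s d) := by
  classical
  obtain ⟨l, hl⟩ := N.proj_surjective.hasRightInverse
  -- One dart of each edge is lifted arbitrarily and the other by reversing that lift. This is why
  -- `inv` carries no voltage in a `Presentation`.
  refine ⟨fun d => if d = (⟦d⟧ : M.Edge).out then l d else N.total.inv (l (M.inv d)), ?_, ?_⟩
  · intro d
    beta_reduce
    split_ifs
    · exact hl d
    · rw [N.proj.map_inv, hl, M.inv_inv]
  · intro d
    simp only [edge_inv]
    rcases edge_eq (Quotient.out_eq (⟦d⟧ : M.Edge)) with h | h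
    · have h2 : M.inv d ≠ (⟦d⟧ : M.Edge).out := by rw [← h]; exact M.inv_ne d
      rw [if_neg h2, if_pos h, M.inv_inv]
    · have h1 : M.inv d = (⟦d⟧ : M.Edge).out := by
        conv_lhs => rw [h]
        rw [M.inv_inv]
      have h2 : d ≠ (⟦d⟧ : M.Edge).out := by rw [← h1]; exact (M.inv_ne d).symm
      rw [if_neg h2, if_pos h1, N.total.inv_inv]

/-- The covering group acts transitively on each fibre by assumption and freely by `aut_ext`, so a
section identifies the darts of the cover with `M.Dart × K`. The voltage of `d` compares the section
at `rot d` with the rotated section at `d`, and exponent `p` makes the covering group a vector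
space. -/
theorem exists_presentation (N : ElemAbCover p M) :
    ∃ (K : Type) (_ : AddCommGroup K) (_ : Module (ZMod p) K) (ν : M.Dart → K)
      (P : Presentation N.total M ν), ∀ d k, N.proj.toFun (P.e (d, k)) = d := by
  obtain ⟨s, hs, hsi⟩ := N.exists_section
  let _ : CommGroup N.proj.deck := { (inferInstance : Group N.proj.deck) with
    mul_comm := N.deck_comm }
  have hdeck : ∀ (k : N.proj.deck) n, N.proj.toFun (k.1.1 n) = N.proj.toFun n := fun k => k.2
  have hν : ∀ d, ∃ k : N.proj.deck, k.1.1 (s (M.rot d)) = N.total.rot (s d) := by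
    intro d
    obtain ⟨g, hg, h⟩ := N.deck_transitive (s (M.rot d)) (N.total.rot (s d))
      (by rw [hs, N.proj.map_rot, hs])
    exact ⟨⟨g, hg⟩, h⟩
  choose ν hν using hν
  let E : M.Dart × Additive N.proj.deck → N.total.Dart := fun x => (x.2.toMul).1.1 (s x.1)
  have hE : Function.Bijective E := by
    constructor
    · rintro ⟨d, k⟩ ⟨d', k'⟩ h
      have h1 := congrArg N.proj.toFun h
      simp only [E, hdeck, hs] at h1
      subst h1
      have : k.toMul.1 = k'.toMul.1 := aut_ext h
      exact Prod.ext rfl (Subtype.ext this)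
    · intro n
      obtain ⟨g, hg, h⟩ := N.deck_transitive (s (N.proj.toFun n)) n (by rw [hs])
      exact ⟨(N.proj.toFun n, Additive.ofMul ⟨g, hg⟩), h⟩
  refine ⟨Additive N.proj.deck, inferInstance, AddCommGroup.zmodModule (n := p) (fun x => ?_),
    fun d => Additive.ofMul (ν d), ⟨Equiv.ofBijective E hE, ?_, ?_⟩, ?_⟩
  · exact congrArg Additive.ofMul (N.deck_exponent x.toMul)
  · intro d k
    change N.total.rot (k.toMul.1.1 (s d)) = (k.toMul * ν d).1.1 (s (M.rot d))
    rw [← aut_rot, ← hν]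
    rfl
  · intro d k
    change N.total.inv (k.toMul.1.1 (s d)) = k.toMul.1.1 (s (M.inv d))
    rw [← aut_inv, hsi]
  · intro d k
    exact (hdeck _ _).trans (hs d)

theorem exists_realizes (N : ElemAbCover p M) :
    ∃ (K : Type) (_ : AddCommGroup K) (_ : Module (ZMod p) K)
      (θ : LinearMap.ker (boundary p M) →ₗ[ZMod p] K), N.Realizes θ := by
  obtain ⟨K, i1, i2, ν, P, hP⟩ := N.exists_presentation
  exact ⟨K, i1, i2, (linearCombination (ZMod p) ν).domRestrict _, ν, P, hP, fun c => rfl⟩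

theorem presentation_fst_symm {N : ElemAbCover p M} {ν : M.Dart → K}
    (P : Presentation N.total M ν) (hP : ∀ d k, N.proj.toFun (P.e (d, k)) = d)
    (n : N.total.Dart) : (P.e.symm n).1 = N.proj.toFun n := by
  obtain ⟨⟨d, k⟩, rfl⟩ := P.e.surjective n
  rw [hP, Equiv.symm_apply_apply]

variable {N N' : ElemAbCover p M} {θ : LinearMap.ker (boundary p M) →ₗ[ZMod p] K}
  {θ' : LinearMap.ker (boundary p M) →ₗ[ZMod p] K'}

theorem Realizes.surjective (h : N.Realizes θ) : Function.Surjective θ := by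
  obtain ⟨ν, P, -, hθ⟩ := h
  intro k
  obtain ⟨c, hc, rfl⟩ := P.surjective (p := p) k
  exact ⟨⟨c, hc⟩, (hθ _).symm⟩

theorem Realizes.map (h : N.Realizes θ) (τ : K ≃ₗ[ZMod p] K') :
    N.Realizes (τ.toLinearMap ∘ₗ θ) := by
  obtain ⟨ν, P, hP, hθ⟩ := h
  refine ⟨_, P.map τ.toAddEquiv, fun d k => hP d _, fun c => ?_⟩
  have : linearCombination (ZMod p) (fun d => τ.toAddEquiv (ν d)) =
      τ.toLinearMap ∘ₗ linearCombination (ZMod p) ν := by ext d; simp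
  rw [this, LinearMap.comp_apply, hθ]
  rfl

theorem Realizes.of_ker_eq (h : N.Realizes θ) (hθ' : Function.Surjective θ')
    (hk : LinearMap.ker θ = LinearMap.ker θ') : N.Realizes θ' := by
  obtain ⟨τ, hτ⟩ := exists_linearEquiv_of_ker_eq h.surjective hθ' hk
  convert h.map τ
  ext c
  exact hτ c

theorem Realizes.equivalent (h : N.Realizes θ) (h' : N'.Realizes θ) : N.Equivalent N' := by
  obtain ⟨ν, P, hP, hθ⟩ := h
  obtain ⟨ν', P', hP', hθ'⟩ := h'
  obtain ⟨d0⟩ := M.nonempty_dart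
  obtain ⟨φ, b, hφ, -⟩ := P.exists_iso P' (autIso 1) (LinearEquiv.refl (ZMod p) K) (by
    intro c hc
    exact (hθ' ⟨c, hc⟩).trans (hθ ⟨c, hc⟩).symm) d0 0
  refine ⟨φ, fun n => ?_⟩
  obtain ⟨⟨d, k⟩, rfl⟩ := P.e.surjective n
  rw [hφ, hP, hP']
  rfl

theorem Realizes.ker_eq (h : N.Realizes θ) (h' : N'.Realizes θ') (he : N.Equivalent N') :
    LinearMap.ker θ = LinearMap.ker θ' := by
  obtain ⟨ν, P, hP, hθ⟩ := h
  obtain ⟨ν', P', hP', hθ'⟩ := h'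
  obtain ⟨φ, hφ⟩ := he
  obtain ⟨τ, b, -, hτ⟩ := P.exists_linearEquiv (p := p) P' (autIso 1) φ (fun d k => by
    rw [presentation_fst_symm P' hP', hφ, hP]; rfl)
  ext c
  rw [LinearMap.mem_ker, LinearMap.mem_ker, ← hθ, ← hθ', ← τ.map_eq_zero_iff, ← hτ c.1 c.2]
  rfl

theorem cls_eq_iff : N.cls = N'.cls ↔ N.Equivalent N' := by
  refine ⟨fun h => Quotient.exact h, fun h => Quotient.sound h⟩

/-- Equal kernels allow both covers to realize the same homomorphism, after which the identity of
the base lifts. Conversely an equivalence matches the two homomorphisms up to a linear isomorphism.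
-/
theorem Realizes.cls_eq_iff (h : N.Realizes θ) (h' : N'.Realizes θ') :
    N.cls = N'.cls ↔ LinearMap.ker θ = LinearMap.ker θ' := by
  rw [ElemAbCover.cls_eq_iff]
  exact ⟨h.ker_eq h', fun hk => (h.of_ker_eq h'.surjective hk).equivalent h'⟩

/-- The action of lifted automorphisms in a presentation. -/
theorem lift_apply {ν : M.Dart → K} (P : Presentation N.total M ν)
    (hP : ∀ d k, N.proj.toFun (P.e (d, k)) = d)
    (hθ : ∀ c : LinearMap.ker (boundary p M), linearCombination (ZMod p) ν c = θ c)
    (g : M.aut) (h : N.total.aut) (hh : ∀ n, N.proj.toFun (h.1 n) = g.1 (N.proj.toFun n)) :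
    ∃ τ : K ≃ₗ[ZMod p] K, ∃ b : M.Dart → K,
      (∀ d k, h.1 (P.e (d, k)) = P.e (g.1 d, b d + τ k)) ∧
      ∀ c, θ (homologyRep p M g c) = τ (θ c) := by
  obtain ⟨τ, b, h1, h2⟩ := P.exists_linearEquiv (p := p) P (autIso g) (autIso h) (fun d k => by
    rw [presentation_fst_symm P hP]; exact (hh _).trans (by rw [hP]; rfl))
  refine ⟨τ, b, h1, fun c => ?_⟩
  rw [← hθ, ← hθ, linearCombination_homologyRep]
  exact h2 c.1 c.2

/-- Orientable regularity of the cover supplies an automorphism with the right image at one dart; by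
rigidity it then covers `g` everywhere. -/
theorem exists_lift (N : ElemAbCover p M) (g : M.aut) :
    ∃ h : N.total.aut, ∀ n, N.proj.toFun (h.1 n) = g.1 (N.proj.toFun n) := by
  obtain ⟨n⟩ := N.total.nonempty_dart
  obtain ⟨n', hn'⟩ := N.proj_surjective (g.1 (N.proj.toFun n))
  obtain ⟨h, hh⟩ := N.orientablyRegular n n'
  refine ⟨h, eq_of_eq_at (N := N.total) (M := M) (f := fun n => N.proj.toFun (h.1 n))
    (g := fun n => g.1 (N.proj.toFun n)) ?_ ?_ ?_ ?_ (a := n) (by rw [hh, hn'])⟩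
  · exact fun d => by rw [aut_rot, N.proj.map_rot]
  · exact fun d => by rw [aut_inv, N.proj.map_inv]
  · exact fun d => by rw [N.proj.map_rot, aut_rot]
  · exact fun d => by rw [N.proj.map_inv, aut_inv]

/-- A lift of `g` acts on the voltage group by some `τ` with `θ ∘ g = τ ∘ θ`. -/
theorem Realizes.ker_invariant (h : N.Realizes θ) (g : M.aut) {c : LinearMap.ker (boundary p M)}
    (hc : θ c = 0) : θ (homologyRep p M g c) = 0 := by
  obtain ⟨ν, P, hP, hθ⟩ := h
  obtain ⟨h, hh⟩ := N.exists_lift g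
  obtain ⟨τ, b, -, h2⟩ := lift_apply P hP hθ g h hh
  rw [h2, hc, map_zero]

/-- The covering group in terms of a presentation. -/
theorem exists_deckEquiv {ν : M.Dart → K} (P : Presentation N.total M ν)
    (hP : ∀ d k, N.proj.toFun (P.e (d, k)) = d) :
    ∃ κ : N.proj.deck ≃* Multiplicative K,
      ∀ (g : N.proj.deck) d k, g.1.1 (P.e (d, k)) = P.e (d, k + (κ g).toAdd) := by
  let f : Multiplicative K →* N.proj.deck :=
    { toFun := fun x => ⟨P.trans x.toAdd, fun n => by
        obtain ⟨⟨d, k⟩, rfl⟩ := P.e.surjective n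
        rw [P.trans_apply, hP, hP]⟩
      map_one' := Subtype.ext P.trans_zero
      map_mul' := fun x y => Subtype.ext (P.trans_mul x.toAdd y.toAdd).symm }
  have hf : ∀ x d k, (f x).1.1 (P.e (d, k)) = P.e (d, k + x.toAdd) := fun x d k =>
    P.trans_apply _ d k
  have hb : Function.Bijective f := by
    obtain ⟨d0⟩ := M.nonempty_dart
    constructor
    · exact fun x y hxy => P.trans_injective (congrArg Subtype.val hxy)
    · intro g
      refine ⟨Multiplicative.ofAdd (P.e.symm (g.1.1 (P.e (d0, 0)))).2,
        Subtype.ext (aut_ext (a := P.e (d0, 0)) ?_)⟩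
      rw [hf, zero_add, toAdd_ofAdd, ← Equiv.eq_symm_apply]
      refine Prod.ext ?_ rfl
      rw [presentation_fst_symm P hP]
      exact ((g.2 _).trans (hP _ _)).symm
  refine ⟨(MulEquiv.ofBijective f hb).symm, fun g d k => ?_⟩
  rw [← hf]
  congr 3
  exact ((MulEquiv.ofBijective f hb).apply_symm_apply g).symm

theorem Realizes.card_deck (h : N.Realizes θ) : Nat.card N.proj.deck = Nat.card K := by
  obtain ⟨ν, P, hP, -⟩ := h
  obtain ⟨κ, -⟩ := exists_deckEquiv P hP
  exact Nat.card_congr (κ.toEquiv.trans Multiplicative.toAdd)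

theorem Realizes.hasRank (h : N.Realizes θ) {c : ℕ} (hc : Nat.card K = p ^ c) : N.HasRank c :=
  h.card_deck.trans hc

theorem Realizes.nontrivial (h : N.Realizes θ) : Nontrivial K := by
  obtain ⟨ν, P, hP, -⟩ := h
  obtain ⟨κ, -⟩ := exists_deckEquiv P hP
  have := N.deck_nontrivial
  exact (κ.toEquiv.trans Multiplicative.toAdd).symm.nontrivial

/-- Conjugation by a lift of `g` acts on translations through the linear part `τ` of the lift. As `θ
∘ g = τ ∘ θ` and `θ` is surjective, `τ` must be `ρ g`. -/
theorem Realizes.affords (h : N.Realizes θ) (ρ : Representation (ZMod p) M.aut K)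
    (hρ : ∀ g c, θ (homologyRep p M g c) = ρ g (θ c)) : N.Affords ρ := by
  have hs := h.surjective
  obtain ⟨ν, P, hP, hθ⟩ := h
  obtain ⟨κ, hκ⟩ := exists_deckEquiv P hP
  refine ⟨κ, fun g h hh k k' hk => ?_⟩
  obtain ⟨τ, b, h1, h2⟩ := lift_apply P hP hθ g h hh
  have hτ : ∀ x, τ x = ρ g x := by
    intro x
    obtain ⟨c, rfl⟩ := hs x
    rw [← h2, hρ]
  obtain ⟨d⟩ := M.nonempty_dart
  have h3 : k'.1.1 (h.1 (P.e (d, 0))) = h.1 (k.1.1 (P.e (d, 0))) := by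
    rw [hk]
    change h.1 (k.1.1 (h.1.symm (h.1 _))) = _
    rw [Equiv.symm_apply_apply]
  rw [h1, hκ, hκ, h1, map_zero, add_zero, zero_add] at h3
  rw [← hτ]
  exact add_left_cancel (Prod.ext_iff.1 (P.e.injective h3)).2

/-- Every nontrivial quotient of the homology module is the covering group of a cover. -/
theorem exists_of_surjective [Finite K] [Nontrivial K] (hM : M.IsOrientablyRegular)
    (hθ : Function.Surjective θ) (ρ : Representation (ZMod p) M.aut K)
    (hρ : ∀ g c, θ (homologyRep p M g c) = ρ g (θ c)) : ∃ N : ElemAbCover p M, N.Realizes θ := by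
  -- Voltages are read off from any extension of `θ` from cycles to all 1-chains.
  obtain ⟨Θ, hΘ⟩ := LinearMap.exists_extend θ
  let ν : M.Dart → K := fun d => Θ (Finsupp.single d 1)
  have hν : linearCombination (ZMod p) ν = Θ := by ext d; simp [ν]
  have hνθ : ∀ c : LinearMap.ker (boundary p M), linearCombination (ZMod p) ν c = θ c := by
    intro c
    rw [hν, ← hΘ]; rfl
  have hsurj : ∀ k, ∃ c ∈ LinearMap.ker (boundary p M), linearCombination (ZMod p) ν c = k := by
    intro k
    obtain ⟨c, rfl⟩ := hθ k
    exact ⟨c.1, c.2, hνθ c⟩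
  let T := voltageMap ν hsurj
  let P : Presentation T M ν := voltageMapPresentation ν hsurj
  let f : T.Cov M := ⟨Prod.fst, fun _ => rfl, fun _ => rfl⟩
  have hdeck : ∀ g : f.deck, ∃ x, g.1 = P.trans x := by
    intro g
    obtain ⟨d0⟩ := M.nonempty_dart
    refine ⟨(P.e.symm (g.1.1 (P.e (d0, 0)))).2, aut_ext (a := P.e (d0, 0)) ?_⟩
    rw [P.trans_apply, ← Equiv.symm_apply_eq, zero_add]
    exact Prod.ext (g.2 _) rfl
  have htrans : ∀ x, P.trans x ∈ f.deck := fun x n => rfl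
  obtain ⟨d0⟩ := M.nonempty_dart
  have hpow : ∀ x (n : ℕ), P.trans x ^ n = P.trans (n • x) := by
    intro x n
    induction n with
    | zero => rw [pow_zero, zero_smul, P.trans_zero]
    | succ n ih => rw [pow_succ, ih, P.trans_mul, succ_nsmul]
  refine ⟨{ total := T
            proj := f
            orientablyRegular := ?_
            deck_transitive := ?_
            deck_comm := ?_
            deck_exponent := ?_
            deck_nontrivial := ?_ }, ν, P, fun _ _ => rfl, hνθ⟩
  · rintro ⟨d, k⟩ ⟨d', k'⟩
    obtain ⟨g, rfl⟩ := hM d d'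
    let τ : K ≃ₗ[ZMod p] K := LinearEquiv.ofLinearMap (ρ g) (ρ g⁻¹)
      (by rw [← Module.End.mul_eq_comp, ← map_mul, mul_inv_cancel, map_one]; rfl)
      (by rw [← Module.End.mul_eq_comp, ← map_mul, inv_mul_cancel, map_one]; rfl)
    -- Equivariance of `θ` lifts `g` with linear part `ρ g`; the free constant is set so that `(d,
    -- k)` goes to `(g d, k')`.
    obtain ⟨φ, b, h1, h2⟩ := P.exists_iso P (autIso g) τ (by
      intro c hc
      have := hρ g ⟨c, hc⟩
      rw [← hνθ, ← hνθ, linearCombination_homologyRep] at this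
      exact this) d (k' - τ k)
    refine ⟨φ.toAut, (h1 d k).trans ?_⟩
    rw [h2, sub_add_cancel]
    rfl
  · rintro ⟨d, k⟩ ⟨d', k'⟩ h
    obtain rfl : d = d' := h
    refine ⟨P.trans (k' - k), htrans _, (P.trans_apply _ d k).trans ?_⟩
    rw [add_sub_cancel]
    rfl
  · intro a b
    obtain ⟨x, hx⟩ := hdeck a
    obtain ⟨y, hy⟩ := hdeck b
    apply Subtype.ext
    change a.1 * b.1 = b.1 * a.1
    rw [hx, hy, P.trans_mul, P.trans_mul, add_comm]
  · intro a
    obtain ⟨x, hx⟩ := hdeck a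
    apply Subtype.ext
    change a.1 ^ p = 1
    rw [hx, hpow, ← Nat.cast_smul_eq_nsmul (ZMod p), CharP.cast_eq_zero, zero_smul, P.trans_zero]
  · obtain ⟨x, hx⟩ := exists_ne (0 : K)
    refine ⟨⟨P.trans x, htrans x⟩, 1, fun h => hx ?_⟩
    have h1 : P.trans x = 1 := congrArg Subtype.val h
    exact P.trans_injective (h1.trans P.trans_zero.symm)

/-- Two projections of one map to `M` are morphisms, so they agree once an automorphism of `M` has
matched them at a single dart. Composing `φ` with a lift of that automorphism makes it an
equivalence of coverings. -/
theorem cls_eq_of_iso (hM : M.IsOrientablyRegular) (φ : N.total.Iso N'.total) :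
    N.cls = N'.cls := by
  obtain ⟨n⟩ := N.total.nonempty_dart
  obtain ⟨g, hg⟩ := hM (N'.proj.toFun (φ.toEquiv n)) (N.proj.toFun n)
  obtain ⟨h, hh⟩ := N'.exists_lift g
  rw [ElemAbCover.cls_eq_iff]
  refine ⟨⟨φ.toEquiv.trans h.1, fun d => ?_, fun d => ?_⟩, ?_⟩
  · simp only [Equiv.trans_apply, φ.map_rot, aut_rot]
  · simp only [Equiv.trans_apply, φ.map_inv, aut_inv]
  · refine eq_of_eq_at (N := N.total) (M := M)
      (f := fun n => N'.proj.toFun ((φ.toEquiv.trans h.1) n)) (fun d => ?_) (fun d => ?_)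
      N.proj.map_rot N.proj.map_inv (a := n) ?_
    · simp only [Equiv.trans_apply, φ.map_rot, aut_rot, N'.proj.map_rot]
    · simp only [Equiv.trans_apply, φ.map_inv, aut_inv, N'.proj.map_inv]
    · rw [Equiv.trans_apply, hh, hg]

/-- A reflection `r` takes the corner from `d` to `rot d` to the corner of `rot⁻¹ (r d)` run
backwards. This explains the shift by `rot⁻¹` and the sign in the hypothesis; for dualities the same
holds, up to `inv`, which does not affect edges. -/
theorem Realizes.iso_mirror (h : N.Realizes θ) (r : M.Iso M.mirror) (τ : K ≃ₗ[ZMod p] K)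
    (hτ : ∀ c : LinearMap.ker (boundary p M), ∃ c' : LinearMap.ker (boundary p M),
      (c' : M.Dart →₀ ZMod p) = Finsupp.mapDomain (fun d => M.rot⁻¹ (r.toEquiv d)) c ∧
        -θ c' = τ (θ c)) : Nonempty (N.total.Iso N.total.mirror) := by
  obtain ⟨ν, P, hP, hθ⟩ := h
  obtain ⟨d0⟩ := M.nonempty_dart
  obtain ⟨φ, -⟩ := P.exists_iso P.mirror r τ (by
    intro c hc
    obtain ⟨c', h1, h2⟩ := hτ ⟨c, hc⟩
    rw [← hθ, ← hθ, h1, Finsupp.linearCombination_mapDomain] at h2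
    rw [← h2, ← LinearMap.neg_apply]
    congr 1
    ext d
    simp) d0 0
  exact ⟨φ⟩

theorem Realizes.iso_dual (h : N.Realizes θ) (h' : N'.Realizes θ') (r : M.Iso M.dual)
    (τ : K ≃ₗ[ZMod p] K')
    (hτ : ∀ c : LinearMap.ker (boundary p M), ∃ c' : LinearMap.ker (boundary p M),
      (c' : M.Dart →₀ ZMod p) = Finsupp.mapDomain (fun d => M.rot⁻¹ (r.toEquiv d)) c ∧
        -θ' c' = τ (θ c)) : Nonempty (N.total.Iso N'.total.dual) := by
  obtain ⟨ν, P, hP, hθ⟩ := h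
  obtain ⟨ν', P', hP', hθ'⟩ := h'
  obtain ⟨d0⟩ := M.nonempty_dart
  obtain ⟨φ, -⟩ := P.exists_iso P'.dual r τ (by
    intro c hc
    obtain ⟨c', h1, h2⟩ := hτ ⟨c, hc⟩
    rw [← hθ, ← hθ', h1, Finsupp.linearCombination_mapDomain] at h2
    rw [← h2, ← LinearMap.neg_apply]
    congr 1
    ext d
    simp) d0 0
  exact ⟨φ⟩

/-- The valencies of a cover. -/
theorem Realizes.minimalPeriod_rot (h : N.Realizes θ) (n : N.total.Dart)
    (hpos : 0 < Function.minimalPeriod M.rot (N.proj.toFun n)) (c : LinearMap.ker (boundary p M))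
    (hc : (c : M.Dart →₀ ZMod p) =
      ∑ i ∈ Finset.range (Function.minimalPeriod M.rot (N.proj.toFun n)),
        Finsupp.single (M.rot^[i] (N.proj.toFun n)) 1) :
    Function.minimalPeriod N.total.rot n =
      Function.minimalPeriod M.rot (N.proj.toFun n) * addOrderOf (θ c) := by
  obtain ⟨ν, P, hP, hθ⟩ := h
  obtain ⟨⟨d, k⟩, rfl⟩ := P.e.surjective n
  rw [hP] at hpos hc ⊢
  rw [minimalPeriod_voltage P.e P.rot d k hpos, ← hθ, hc]
  simp

/-- The face sizes of a cover. -/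
theorem Realizes.minimalPeriod_face (h : N.Realizes θ) (n : N.total.Dart)
    (hpos : 0 < Function.minimalPeriod M.face (N.proj.toFun n)) (c : LinearMap.ker (boundary p M))
    (hc : (c : M.Dart →₀ ZMod p) =
      ∑ i ∈ Finset.range (Function.minimalPeriod M.face (N.proj.toFun n)),
        Finsupp.single (M.rot⁻¹ (M.face^[i] (N.proj.toFun n))) 1) :
    Function.minimalPeriod N.total.face n =
      Function.minimalPeriod M.face (N.proj.toFun n) * addOrderOf (θ c) := by
  obtain ⟨ν, P, hP, hθ⟩ := h
  obtain ⟨⟨d, k⟩, rfl⟩ := P.e.surjective n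
  rw [hP] at hpos hc ⊢
  rw [minimalPeriod_voltage P.e P.face d k hpos, ← hθ, hc, ← addOrderOf_neg]
  simp

end ElemAbCover

end OMap

/-! ### Coordinates on the homology of the punctured tetrahedral sphere. -/

namespace Tetra

open OMap Finsupp

instance : Fintype tetrahedron.Dart := inferInstanceAs (Fintype TDart)

instance : DecidableEq tetrahedron.Dart := inferInstanceAs (DecidableEq TDart)

/-- The initial vertex of a dart. -/
def vert (d : tetrahedron.Dart) : Fin 4 := d.1.1

/-- The vertex opposite to the face that has its corner between `d` and `rot d`. -/
def opp (d : tetrahedron.Dart) : Fin 4 := next d.1.1 (next d.1.1 d.1.2)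

/-- Written with `rot`, `inv` and `vert` only, `opp` is visibly equivariant. -/
theorem opp_eq (d : tetrahedron.Dart) :
    opp d = vert (tetrahedron.inv (tetrahedron.rot (tetrahedron.rot d))) := by
  revert d; decide

theorem vert_aut (g : tetrahedron.aut) (d : tetrahedron.Dart) : vert (g.1 d) = autVert g (vert d) :=
  autVert_eq g d

theorem opp_aut (g : tetrahedron.aut) (d : tetrahedron.Dart) : opp (g.1 d) = autVert g (opp d) := by
  rw [opp_eq, opp_eq, ← aut_rot, ← aut_rot, ← aut_inv, vert_aut]

/-- The automorphism with a given action on the vertices. -/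
def autOf (s : Equiv.Perm (Fin 4)) (h : ∀ i j, next (s i) (s j) = s (next i j)) :
    tetrahedron.aut :=
  Iso.toAut (M := tetrahedron)
    { toEquiv :=
        { toFun := fun d => ⟨(s d.1.1, s d.1.2), fun e => d.2 (s.injective e)⟩
          invFun := fun d => ⟨(s.symm d.1.1, s.symm d.1.2), fun e => d.2 (s.symm.injective e)⟩
          left_inv := fun _ => Subtype.ext (Prod.ext (s.symm_apply_apply _) (s.symm_apply_apply _))
          right_inv := fun _ =>
            Subtype.ext (Prod.ext (s.apply_symm_apply _) (s.apply_symm_apply _)) }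
      map_rot := fun d => Subtype.ext (Prod.ext rfl (h d.1.1 d.1.2).symm)
      map_inv := fun _ => rfl }

/-- The half-turn with axis along a coordinate axis. -/
def halfTurn (a : Fin 3) : tetrahedron.aut :=
  autOf (![Equiv.swap 0 1 * Equiv.swap 2 3, Equiv.swap 0 2 * Equiv.swap 1 3,
    Equiv.swap 0 3 * Equiv.swap 1 2] a) (by revert a; decide)

/-- The rotation of order three about the vertex `0`. -/
def threeTurn : tetrahedron.aut := autOf (Equiv.swap 1 2 * Equiv.swap 2 3) (by decide)

/-- The group `A₄` is the product of a cyclic group of order three and the Klein four-group, and its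
twelve elements carry one dart to all twelve. -/
theorem orientablyRegular : tetrahedron.IsOrientablyRegular := by
  have key : ∀ a : tetrahedron.Dart, ∃ i j : Fin 3, ∃ e : Fin 2,
      (threeTurn.1 ^ (i : ℕ) * (halfTurn j).1 ^ (e : ℕ)) ⟨(0, 1), by decide⟩ = a := by
    decide
  intro a b
  obtain ⟨i, j, e, ha⟩ := key a
  obtain ⟨i', j', e', hb⟩ := key b
  refine ⟨(threeTurn ^ (i' : ℕ) * halfTurn j' ^ (e' : ℕ)) *
    (threeTurn ^ (i : ℕ) * halfTurn j ^ (e : ℕ))⁻¹, ?_⟩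
  rw [← ha, ← hb]
  change (threeTurn.1 ^ (i' : ℕ) * (halfTurn j').1 ^ (e' : ℕ))
    ((threeTurn.1 ^ (i : ℕ) * (halfTurn j).1 ^ (e : ℕ)).symm _) = _
  exact congrArg _ (Equiv.symm_apply_apply _ _)

variable (p : ℕ)

/-- The scalar product of the position vector of a vertex with a vector. -/
def posDot (i : Fin 4) (u : Fin 3 → ZMod p) : ZMod p := ∑ a, (pos i a : ZMod p) * u a

/-- The position vectors of the vertices mod `p`. -/
def posVec (i : Fin 4) : Fin 3 → ZMod p := fun a => pos i a

/-- The module `ρ₁ ⊕ ρ₄ ⊕ ρ₄`. -/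
abbrev Mod : Type := ZMod p × (Fin 3 → ZMod p) × (Fin 3 → ZMod p)

noncomputable abbrev modRep : Representation (ZMod p) tetrahedron.aut (Mod p) :=
  (rho1 p).prod ((rho4 p).prod (rho4 p))

variable {p}

theorem modRep_apply (g : tetrahedron.aut) (x : Mod p) :
    modRep p g x = (x.1, rho4 p g x.2.1, rho4 p g x.2.2) := rfl

theorem rho4_apply (g : tetrahedron.aut) (u : Fin 3 → ZMod p) (a : Fin 3) :
    rho4 p g u a = ∑ b, (symMatrix (autVert g) a b : ZMod p) * u b := rfl

/-- Symmetries of the tetrahedron are orthogonal, so they preserve scalar products with the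
vertices. -/
theorem posDot_symMatrix : ∀ (s : Equiv.Perm (Fin 4)) (i : Fin 4) (b : Fin 3),
    ∑ a, pos (s i) a * symMatrix s a b = pos i b := by decide

/-- An automorphism as a permutation of the vertices. -/
noncomputable def autPerm (g : tetrahedron.aut) : Equiv.Perm (Fin 4) :=
  Equiv.ofBijective (autVert g) (Finite.injective_iff_bijective.1 (autVert_injective g))

theorem posDot_rho4 (g : tetrahedron.aut) (i : Fin 4) (u : Fin 3 → ZMod p) :
    posDot p (autVert g i) (rho4 p g u) = posDot p i u := by
  have h : ∀ b, ∑ a, (pos (autVert g i) a : ZMod p) * (symMatrix (autVert g) a b : ZMod p) =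
      pos i b := fun b => by
    have := posDot_symMatrix (autPerm g) i b
    exact_mod_cast congrArg (Int.cast : ℤ → ZMod p) this
  simp only [posDot, rho4_apply, Finset.mul_sum]
  rw [Finset.sum_comm]
  refine Finset.sum_congr rfl fun b _ => ?_
  rw [← h b, Finset.sum_mul]
  exact Finset.sum_congr rfl fun a _ => (mul_assoc _ _ _).symm

theorem rho4_posVec (g : tetrahedron.aut) (i : Fin 4) :
    rho4 p g (posVec p i) = posVec p (autVert g i) := by
  funext a
  have := congrFun (symMatrix_apply_pos (autPerm g) i) a
  have := congrArg (Int.cast : ℤ → ZMod p) this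
  rw [rho4_apply]
  simp only [Matrix.mulVec, dotProduct, Int.cast_sum, Int.cast_mul] at this
  exact this

variable (p) in
/-- The 1-chain with coefficients `t + ⟨pos i, u⟩ + ⟨pos k, v⟩` at the corner of the vertex `i` in the
face opposite to `k`. -/
noncomputable def chain : Mod p →ₗ[ZMod p] (tetrahedron.Dart →₀ ZMod p) :=
  (Finsupp.linearEquivFunOnFinite (ZMod p) (ZMod p) tetrahedron.Dart).symm.toLinearMap ∘ₗ
    { toFun := fun x d => x.1 + posDot p (vert d) x.2.1 + posDot p (opp d) x.2.2
      map_add' := fun x y => by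
        funext d
        simp only [posDot, Prod.fst_add, Prod.snd_add, Pi.add_apply, mul_add,
          Finset.sum_add_distrib]
        ring
      map_smul' := fun r x => by
        funext d
        simp only [posDot, Prod.smul_fst, Prod.smul_snd, Pi.smul_apply, smul_eq_mul,
          mul_left_comm _ r, RingHom.id_apply, ← Finset.mul_sum]
        ring }

theorem chain_apply (x : Mod p) (d : tetrahedron.Dart) :
    chain p x d = x.1 + posDot p (vert d) x.2.1 + posDot p (opp d) x.2.2 := rfl

/-- Flow balance at the midpoint of an edge: two corners enter it and two leave it, one for each of
its darts. -/
theorem mem_ker_boundary {M : OMap} (c : M.Dart →₀ ZMod p) :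
    c ∈ LinearMap.ker (boundary p M) ↔
      ∀ d, c (M.rot⁻¹ d) + c (M.rot⁻¹ (M.inv d)) = c d + c (M.inv d) := by
  classical
  have h1 : ∀ (c : M.Dart →₀ ZMod p) d,
      Finsupp.mapDomain (fun x => (⟦x⟧ : M.Edge)) c ⟦d⟧ = c d + c (M.inv d) := by
    intro c d
    induction c using Finsupp.induction_linear with
    | zero => simp
    | add f g hf hg => rw [Finsupp.mapDomain_add, Finsupp.add_apply, hf, hg]; simp only [
        Finsupp.add_apply]; ring
    | single x r =>
      rw [Finsupp.mapDomain_single, Finsupp.single_apply, Finsupp.single_apply,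
        Finsupp.single_apply]
      by_cases hx : x = d
      · subst hx
        rw [if_pos rfl, if_pos rfl, if_neg (M.inv_ne x).symm, add_zero]
      · by_cases hx' : x = M.inv d
        · subst hx'
          rw [if_pos (edge_inv M d), if_neg hx, if_pos rfl, zero_add]
        · rw [if_neg hx, if_neg hx', if_neg, add_zero]
          intro h
          rcases edge_eq h.symm with h | h
          · exact hx h
          · exact hx' h
  have h2 : ∀ d, Finsupp.mapDomain (fun x => (⟦M.rot x⟧ : M.Edge)) c ⟦d⟧ =
      c (M.rot⁻¹ d) + c (M.rot⁻¹ (M.inv d)) := by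
    intro d
    have : Finsupp.mapDomain (fun x => (⟦M.rot x⟧ : M.Edge)) c =
        Finsupp.mapDomain (fun x => (⟦x⟧ : M.Edge)) (Finsupp.mapDomain M.rot c) :=
      Finsupp.mapDomain_comp
    rw [this, h1, Finsupp.mapDomain_equiv_apply, Finsupp.mapDomain_equiv_apply]
    rfl
  rw [LinearMap.mem_ker, boundary, LinearMap.sub_apply, sub_eq_zero, Finsupp.ext_iff]
  refine ⟨fun h d => ?_, fun h q => ?_⟩
  · rw [← h1, ← h2]
    exact h ⟦d⟧
  · induction q using Quotient.inductionOn with | _ d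
    exact (h2 d).trans ((h d).trans (h1 c d).symm)

/-- At each edge, the two entering and the two leaving corners involve the same two vertices and the
same two faces, so their affine values have equal sums. -/
theorem chain_mem (x : Mod p) : chain p x ∈ LinearMap.ker (boundary p tetrahedron) := by
  rw [mem_ker_boundary]
  intro d
  have h : ∀ d : tetrahedron.Dart, vert (tetrahedron.rot⁻¹ d) = vert d ∧
      opp (tetrahedron.rot⁻¹ d) = opp (tetrahedron.inv d) := by decide
  simp only [chain_apply]
  rw [(h d).1, (h d).2, (h _).1, (h _).2, tetrahedron.inv_inv]
  ring

theorem mapDomain_chain (f : tetrahedron.Dart ≃ tetrahedron.Dart) {x y : Mod p}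
    (h : ∀ d, chain p y (f d) = chain p x d) : Finsupp.mapDomain f (chain p x) = chain p y := by
  ext d
  obtain ⟨d, rfl⟩ := f.surjective d
  rw [h, Finsupp.mapDomain_equiv_apply, Equiv.symm_apply_apply]

theorem chain_modRep (g : tetrahedron.aut) (x : Mod p) :
    Finsupp.mapDomain g.1 (chain p x) = chain p (modRep p g x) := by
  refine mapDomain_chain g.1 fun d => ?_
  rw [chain_apply, chain_apply, modRep_apply, vert_aut, opp_aut, posDot_rho4, posDot_rho4]

theorem zmod_four_ne_zero [Fact p.Prime] (hp : p ≠ 2) : (4 : ZMod p) ≠ 0 := by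
  have h2 : (2 : ZMod p) ≠ 0 := by
    have := Fact.out (p := p.Prime)
    intro h
    have h' : ((2 : ℕ) : ZMod p) = 0 := by exact_mod_cast h
    rw [ZMod.natCast_eq_zero_iff] at h'
    exact hp ((Nat.prime_dvd_prime_iff_eq this Nat.prime_two).1 h')
  have : (4 : ZMod p) = 2 * 2 := by norm_num
  rw [this]
  exact mul_ne_zero h2 h2

end Tetra

namespace Tetra

open OMap Finsupp

variable {p : ℕ} [Fact p.Prime]

/-- The values are known at all pairs `i ≠ k`. Since the position vectors sum to `0` and `∑ pos i *
(pos i)ᵀ = 4`, suitable weighted sums of these values isolate `u` and `v`. -/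
theorem chain_injective (hp : p ≠ 2) : Function.Injective (chain p) := by
  rw [← LinearMap.ker_eq_bot, LinearMap.ker_eq_bot']
  rintro ⟨t, u, v⟩ h
  have h4 := zmod_four_ne_zero hp
  have h32 : (32 : ZMod p) ≠ 0 := by
    have h2 : (2 : ZMod p) ≠ 0 := by
      intro h; apply h4; linear_combination 2 * h
    have : (32 : ZMod p) = 4 * 4 * 2 := by norm_num
    rw [this]
    exact mul_ne_zero (mul_ne_zero h4 h4) h2
  have hd : ∀ i j : Fin 4, i ≠ j →
      t + posDot p i u + posDot p (next i (next i j)) v = 0 := fun i j hij =>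
    DFunLike.congr_fun h (⟨(i, j), hij⟩ : TDart)
  have key : ∀ i k : Fin 4, i ≠ k → t + posDot p i u + posDot p k v = 0 := by
    intro i k hik
    have : next i (next i (next i k)) = k ∧ i ≠ next i k := by revert i k; decide
    rw [← hd i (next i k) this.2, this.1]
  have solve : ∀ x : ZMod p, 32 * x = 0 → x = 0 := fun x hx =>
    (mul_eq_zero.1 hx).resolve_left h32
  -- With weights `3 * pos i + pos k`, the sum over all pairs is `48 u + 16 v` and the diagonal part
  -- is `16 (u + v)`, leaving `32 u`. Exchanging the weights isolates `v`.
  have hu : u = 0 := by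
    funext a
    apply solve
    have : ∀ a : Fin 3, 32 * u a = ∑ i, ∑ k, if i = k then 0 else
      (3 * (pos i a : ZMod p) + pos k a) * (t + posDot p i u + posDot p k v) := by
      intro a
      fin_cases a <;>
      · simp [Fin.sum_univ_four, posDot, pos, Fin.sum_univ_three]
        ring
    rw [this]
    refine Finset.sum_eq_zero fun i _ => Finset.sum_eq_zero fun k _ => ?_
    split_ifs with hik
    · rfl
    · rw [key i k hik, mul_zero]
  have hv : v = 0 := by
    funext a
    apply solve
    have : ∀ a : Fin 3, 32 * v a = ∑ i, ∑ k, if i = k then 0 else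
      ((pos i a : ZMod p) + 3 * pos k a) * (t + posDot p i u + posDot p k v) := by
      intro a
      fin_cases a <;>
      · simp [Fin.sum_univ_four, posDot, pos, Fin.sum_univ_three]
        ring
    rw [this]
    refine Finset.sum_eq_zero fun i _ => Finset.sum_eq_zero fun k _ => ?_
    split_ifs with hik
    · rfl
    · rw [key i k hik, mul_zero]
  have ht : t = 0 := by
    have := key 0 1 (by decide)
    simpa [hu, hv, posDot] using this
  rw [ht, hu, hv]
  rfl

/-- A cycle is determined by its coefficients outside a spanning tree of the medial graph. -/
theorem finrank_ker_boundary_le :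
    Module.finrank (ZMod p) (LinearMap.ker (boundary p tetrahedron)) ≤ 7 := by
  -- The medial graph is an octahedron with 6 vertices and 12 edges. The five corners not listed
  -- form a spanning tree, leaving `12 - 5 = 7`.
  let D : Fin 7 → TDart := ![⟨(0, 3), by decide⟩, ⟨(1, 3), by decide⟩, ⟨(2, 0), by decide⟩,
    ⟨(2, 3), by decide⟩, ⟨(3, 0), by decide⟩, ⟨(3, 1), by decide⟩, ⟨(3, 2), by decide⟩]
  let f : (tetrahedron.Dart →₀ ZMod p) →ₗ[ZMod p] (Fin 7 → ZMod p) :=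
    LinearMap.pi fun i => Finsupp.lapply (D i : tetrahedron.Dart)
  have hf : Function.Injective (f.domRestrict (LinearMap.ker (boundary p tetrahedron))) := by
    refine (injective_iff_map_eq_zero _).2 ?_
    rintro ⟨c, hc⟩ h
    rw [mem_ker_boundary] at hc
    let ev : Fin 4 → Fin 4 → ZMod p := fun i j =>
      if hij : i ≠ j then c (⟨(i, j), hij⟩ : TDart) else 0
    have hev : ∀ d : TDart, ev d.1.1 d.1.2 = c d := fun d => dif_pos d.2
    have hD : ∀ i, ev (D i).1.1 (D i).1.2 = 0 := fun i => by rw [hev]; exact congrFun h i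
    have he : ∀ i j : Fin 4, i ≠ j →
        ev i (next i (next i j)) + ev j (next j (next j i)) = ev i j + ev j i := by
      intro i j hij
      have := hc (⟨(i, j), hij⟩ : TDart)
      exact (congrArg₂ (· + ·) (hev _) (hev _)).trans
        (this.trans (congrArg₂ (· + ·) (hev _).symm (hev _).symm))
    have z03 : ev 0 3 = 0 := hD 0
    have z13 : ev 1 3 = 0 := hD 1
    have z20 : ev 2 0 = 0 := hD 2
    have z23 : ev 2 3 = 0 := hD 3
    have z30 : ev 3 0 = 0 := hD 4
    have z31 : ev 3 1 = 0 := hD 5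
    have z32 : ev 3 2 = 0 := hD 6
    -- The tree is stripped from its leaves, the edges `03`, `13` and `23` of the tetrahedron: each
    -- balance equation has one coefficient not yet known to vanish.
    have z02 : ev 0 2 = 0 := by
      simpa [next, z03, z30, z31] using he 0 3 (by decide)
    have z10 : ev 1 0 = 0 := by
      simpa [next, z13, z31, z32] using he 1 3 (by decide)
    have z21 : ev 2 1 = 0 := by
      simpa [next, z23, z32, z30] using he 2 3 (by decide)
    have z01 : ev 0 1 = 0 := by
      simpa [next, z02, z20, z23] using he 0 2 (by decide)
    have z12 : ev 1 2 = 0 := by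
      simpa [next, z01, z10, z03] using he 0 1 (by decide)
    have hdiag : ∀ i, ev i i = 0 := fun i => dif_neg (fun h => h rfl)
    have hall : ∀ i j, ev i j = 0 := by
      intro i j
      fin_cases i <;> fin_cases j <;> first | exact hdiag _ | assumption
    refine Subtype.ext (Finsupp.ext fun d => ?_)
    exact (hev d).symm.trans (hall _ _)
  have := LinearMap.finrank_le_finrank_of_injective hf
  simpa using this

theorem finrank_mod : Module.finrank (ZMod p) (Mod p) = 7 := by
  simp

/-- The homology of the punctured sphere. -/
noncomputable def modEquiv (hp : p ≠ 2) :
    Mod p ≃ₗ[ZMod p] LinearMap.ker (boundary p tetrahedron) :=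
  LinearEquiv.ofBijective ((chain p).codRestrict _ chain_mem) (by
    have hi : Function.Injective
        ((chain p).codRestrict (LinearMap.ker (boundary p tetrahedron)) chain_mem) :=
      fun x y h => chain_injective hp (congrArg Subtype.val h)
    refine ⟨hi, ?_⟩
    refine (LinearMap.injective_iff_surjective_of_finrank_eq_finrank (K := ZMod p) (V := Mod p)
      (V₂ := LinearMap.ker (boundary p tetrahedron)) ?_).1 hi
    refine le_antisymm (LinearMap.finrank_le_finrank_of_injective hi) ?_
    rw [finrank_mod]
    exact finrank_ker_boundary_le)

theorem coe_modEquiv (hp : p ≠ 2) (x : Mod p) :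
    (modEquiv hp x : tetrahedron.Dart →₀ ZMod p) = chain p x := rfl

theorem modEquiv_modRep (hp : p ≠ 2) (g : tetrahedron.aut) (x : Mod p) :
    modEquiv hp (modRep p g x) = homologyRep p tetrahedron g (modEquiv hp x) :=
  Subtype.ext (chain_modRep g x).symm

/-! ### The permutation module on the punctures. -/

/-- The vertex of the tetrahedron corresponding to a cycle of `rot`. -/
def vertexIndex : tetrahedron.Vertex → Fin 4 :=
  Quotient.lift vert (by
    rintro a b ⟨n, rfl⟩
    have h : ∀ (n : ℕ) d, vert ((tetrahedron.rot ^ n) d) = vert d := by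
      intro n
      induction n with
      | zero => exact fun d => rfl
      | succ n ih => exact fun d => by rw [pow_succ, Equiv.Perm.mul_apply, ih]; rfl
    obtain ⟨m, hm⟩ := (isOfFinOrder_of_finite tetrahedron.rot).mem_powers_iff_mem_zpowers.2 ⟨n, rfl⟩
    exact (h m a).symm.trans (congrArg (fun s : Equiv.Perm tetrahedron.Dart => vert (s a)) hm))

/-- The vertex of the tetrahedron opposite to a face. -/
def faceIndex : tetrahedron.Face → Fin 4 :=
  Quotient.lift (fun d => opp (tetrahedron.rot⁻¹ d)) (by
    rintro a b ⟨n, rfl⟩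
    -- As `face d = inv (rot⁻¹ d)`, the face cycle of `d` turns at the corner between `rot⁻¹ d` and
    -- `d`; hence the shift by `rot⁻¹`.
    have h1 : ∀ d, opp (tetrahedron.rot⁻¹ (tetrahedron.face d)) = opp (tetrahedron.rot⁻¹ d) := by
      decide
    have h : ∀ (n : ℕ) d, opp (tetrahedron.rot⁻¹ ((tetrahedron.face ^ n) d)) =
        opp (tetrahedron.rot⁻¹ d) := by
      intro n
      induction n with
      | zero => exact fun d => rfl
      | succ n ih => exact fun d => by rw [pow_succ, Equiv.Perm.mul_apply, ih, h1]
    obtain ⟨m, hm⟩ := (isOfFinOrder_of_finite tetrahedron.face).mem_powers_iff_mem_zpowers.2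
      ⟨n, rfl⟩
    exact (h m a).symm.trans (congrArg (fun s : Equiv.Perm tetrahedron.Dart =>
      opp (tetrahedron.rot⁻¹ (s a))) hm))

theorem vertexIndex_bijective : Function.Bijective vertexIndex := by
  constructor
  · rintro ⟨a⟩ ⟨b⟩ h
    have key : ∀ a b : tetrahedron.Dart, vert a = vert b →
        ∃ n : Fin 3, (tetrahedron.rot ^ (n : ℕ)) a = b := by decide
    obtain ⟨n, hn⟩ := key a b h
    exact Quotient.sound ⟨n, by simpa using hn⟩
  · have key : ∀ i, ∃ d : tetrahedron.Dart, vert d = i := by decide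
    intro i
    obtain ⟨d, hd⟩ := key i
    exact ⟨⟦d⟧, hd⟩

theorem faceIndex_bijective : Function.Bijective faceIndex := by
  constructor
  · rintro ⟨a⟩ ⟨b⟩ h
    have key : ∀ a b : tetrahedron.Dart, opp (tetrahedron.rot⁻¹ a) = opp (tetrahedron.rot⁻¹ b) →
        ∃ n : Fin 3, (tetrahedron.face ^ (n : ℕ)) a = b := by decide
    obtain ⟨n, hn⟩ := key a b h
    exact Quotient.sound ⟨n, by simpa using hn⟩
  · have key : ∀ i, ∃ d : tetrahedron.Dart, opp (tetrahedron.rot⁻¹ d) = i := by decide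
    intro i
    obtain ⟨d, hd⟩ := key i
    exact ⟨⟦d⟧, hd⟩

theorem vertexIndex_aut (g : tetrahedron.aut) (q : tetrahedron.Vertex) :
    vertexIndex (autVertex g q) = autVert g (vertexIndex q) := by
  induction q using Quotient.inductionOn with | _ d
  exact vert_aut g d

theorem faceIndex_aut (g : tetrahedron.aut) (q : tetrahedron.Face) :
    faceIndex (autFace g q) = autVert g (faceIndex q) := by
  induction q using Quotient.inductionOn with | _ d
  change opp (tetrahedron.rot⁻¹ (g.1 d)) = autVert g (opp (tetrahedron.rot⁻¹ d))
  rw [← opp_aut]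
  congr 1
  rw [Equiv.Perm.inv_eq_iff_eq, ← aut_rot]
  exact congrArg g.1 (tetrahedron.rot.apply_symm_apply d).symm

/-- The element of `ρ₁ ⊕ ρ₄ ⊕ ρ₄` corresponding to a puncture. -/
def punctureVec : tetrahedron.Face ⊕ tetrahedron.Vertex → Mod p :=
  Sum.elim (fun f => (-1, 0, posVec p (faceIndex f))) (fun v => (1, posVec p (vertexIndex v), 0))

theorem punctureVec_aut (g : tetrahedron.aut) (x : tetrahedron.Face ⊕ tetrahedron.Vertex) :
    punctureVec (p := p) (Sum.map (autFace g) (autVertex g) x) = modRep p g (punctureVec x) := by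
  rcases x with f | v
  · simp [punctureVec, faceIndex_aut, rho4_posVec, rho1]
  · simp [punctureVec, vertexIndex_aut, rho4_posVec, rho1]

theorem sum_vertex {V : Type*} [AddCommMonoid V] [Fintype tetrahedron.Vertex] (f : Fin 4 → V) :
    ∑ v, f (vertexIndex v) = ∑ i, f i :=
  Fintype.sum_bijective vertexIndex vertexIndex_bijective _ _ fun _ => rfl

theorem sum_face {V : Type*} [AddCommMonoid V] [Fintype tetrahedron.Face] (f : Fin 4 → V) :
    ∑ v, f (faceIndex v) = ∑ i, f i :=
  Fintype.sum_bijective faceIndex faceIndex_bijective _ _ fun _ => rfl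

noncomputable instance : Fintype tetrahedron.Vertex := Fintype.ofFinite _

noncomputable instance : Fintype tetrahedron.Face := Fintype.ofFinite _

theorem linearCombination_eq_sum {α V : Type*} [Fintype α] [AddCommGroup V] [Module (ZMod p) V]
    (c : α →₀ ZMod p) (w : α → V) : Finsupp.linearCombination (ZMod p) w c = ∑ x, c x • w x := by
  rw [Finsupp.linearCombination_apply]
  exact Finsupp.sum_fintype _ _ (fun _ => zero_smul _ _)

/-- The signs in `punctureVec` make the four faces cancel the four vertices in `ρ₁`, and the
position vectors sum to zero. -/
theorem linearCombination_punctureSum :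
    Finsupp.linearCombination (ZMod p) punctureVec (punctureSum p tetrahedron) = (0 : Mod p) := by
  rw [linearCombination_eq_sum]
  simp only [punctureSum, Finsupp.equivFunOnFinite_symm_apply_apply, one_smul, Fintype.sum_sum_type,
    punctureVec, Sum.elim_inl, Sum.elim_inr]
  rw [sum_vertex (fun i => ((1, posVec p i, 0) : Mod p)),
    sum_face (fun i => ((-1, 0, posVec p i) : Mod p))]
  have h : ∀ a, ∑ i, posVec p i a = 0 := by
    intro a
    fin_cases a <;> simp [Fin.sum_univ_four, posVec, pos]
  ext a <;> simp [Prod.fst_sum, Prod.snd_sum, h]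

theorem linearCombination_punctureVec_surjective (hp : p ≠ 2) :
    Function.Surjective (Finsupp.linearCombination (ZMod p)
      (punctureVec : tetrahedron.Face ⊕ tetrahedron.Vertex → Mod p)) := by
  intro x
  have h4 := zmod_four_ne_zero hp
  -- Inversion by `∑ pos i * (pos i)ᵀ = 4`. The component in `ρ₁` is produced by the vertices alone,
  -- since the face coefficients sum to zero.
  refine ⟨Finsupp.equivFunOnFinite.symm (Sum.elim (fun f => 4⁻¹ * posDot p (faceIndex f) x.2.2)
    (fun v => 4⁻¹ * (x.1 + posDot p (vertexIndex v) x.2.1))), ?_⟩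
  rw [linearCombination_eq_sum]
  simp only [Finsupp.equivFunOnFinite_symm_apply_apply, Fintype.sum_sum_type,
    punctureVec, Sum.elim_inl, Sum.elim_inr]
  rw [sum_vertex (fun i => (4⁻¹ * (x.1 + posDot p i x.2.1)) • ((1, posVec p i, 0) : Mod p)),
    sum_face (fun i => (4⁻¹ * posDot p i x.2.2) • ((-1, 0, posVec p i) : Mod p))]
  obtain ⟨t, u, v⟩ := x
  ext a
  · simp [Fin.sum_univ_four, posDot, pos, Fin.sum_univ_three]
    field_simp
    ring
  · fin_cases a <;>
    · simp [Prod.fst_sum, Prod.snd_sum, Fin.sum_univ_four, posDot, pos, posVec, Fin.sum_univ_three]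
      field_simp
      ring
  · fin_cases a <;>
    · simp [Prod.fst_sum, Prod.snd_sum, Fin.sum_univ_four, posDot, pos, posVec, Fin.sum_univ_three]
      field_simp
      ring

theorem span_punctureSum_le : Submodule.span (ZMod p) {punctureSum p tetrahedron} ≤
    LinearMap.ker (Finsupp.linearCombination (ZMod p)
      (punctureVec : tetrahedron.Face ⊕ tetrahedron.Vertex → Mod p)) := by
  rw [Submodule.span_singleton_le_iff_mem, LinearMap.mem_ker, linearCombination_punctureSum]

/-- The permutation module on the punctures modulo the sum of the punctures. -/
noncomputable def punctureEquiv (hp : p ≠ 2) :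
    ((tetrahedron.Face ⊕ tetrahedron.Vertex →₀ ZMod p) ⧸
      Submodule.span (ZMod p) {punctureSum p tetrahedron}) ≃ₗ[ZMod p] Mod p :=
  LinearEquiv.ofBijective (Submodule.liftQ _ _ span_punctureSum_le) (by
    have hs : Function.Surjective (Submodule.liftQ (Submodule.span (ZMod p)
        {punctureSum p tetrahedron}) _ (span_punctureSum_le (p := p))) := by
      intro x
      obtain ⟨c, rfl⟩ := linearCombination_punctureVec_surjective hp x
      exact ⟨Submodule.Quotient.mk c, rfl⟩
    refine ⟨?_, hs⟩
    rw [LinearMap.injective_iff_surjective_of_finrank_eq_finrank]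
    · exact hs
    · have h0 : punctureSum p tetrahedron ≠ 0 := by
        obtain ⟨d⟩ := tetrahedron.nonempty_dart
        intro h
        have := DFunLike.congr_fun h (Sum.inl ⟦d⟧)
        exact one_ne_zero (α := ZMod p) this
      have h1 := finrank_span_singleton (K := ZMod p) h0
      have h2 := Submodule.finrank_quotient_add_finrank
        (Submodule.span (ZMod p) {punctureSum p tetrahedron})
      have h3 : Module.finrank (ZMod p) (tetrahedron.Face ⊕ tetrahedron.Vertex →₀ ZMod p) = 8 := by
        rw [Module.finrank_finsupp_self, Fintype.card_sum,
          Fintype.card_of_bijective vertexIndex_bijective,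
          Fintype.card_of_bijective faceIndex_bijective]
        rfl
      rw [h1, h3] at h2
      rw [finrank_mod]
      omega)

theorem punctureEquiv_rep (hp : p ≠ 2) (g : tetrahedron.aut) (q) :
    punctureEquiv hp (punctureQuotientRep p tetrahedron g q) = modRep p g (punctureEquiv hp q) := by
  induction q using Submodule.Quotient.induction_on with | _ c
  change Finsupp.linearCombination (ZMod p) punctureVec (Finsupp.mapDomain _ c) =
    modRep p g (Finsupp.linearCombination (ZMod p) punctureVec c)
  rw [Finsupp.linearCombination_mapDomain, ← LinearMap.comp_apply]
  congr 1
  ext1 x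
  ext1
  simp only [LinearMap.comp_apply, Finsupp.lsingle_apply, Finsupp.linearCombination_single,
    Function.comp_apply, one_smul]
  exact punctureVec_aut g x

theorem homologyRep_equiv_modRep (hp : p ≠ 2) :
    Nonempty ((homologyRep p tetrahedron).Equiv (modRep p)) :=
  ⟨(Representation.Equiv.mk (modEquiv hp) fun g =>
    LinearMap.ext fun x => modEquiv_modRep hp g x).symm⟩

theorem homologyRep_equiv_punctureQuotientRep (hp : p ≠ 2) :
    Nonempty ((homologyRep p tetrahedron).Equiv (punctureQuotientRep p tetrahedron)) :=
  ⟨(Representation.Equiv.mk (punctureEquiv hp ≪≫ₗ modEquiv hp) fun g =>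
    LinearMap.ext fun _ =>
      (congrArg _ (punctureEquiv_rep hp g _)).trans (modEquiv_modRep hp g _)).symm⟩

end Tetra

/-! ### Invariant submodules and irreducibility. -/

namespace Tetra

open OMap OMap.ElemAbCover Finsupp

variable {p : ℕ} [Fact p.Prime]

theorem rho4_halfTurn (a : Fin 3) (u : Fin 3 → ZMod p) :
    rho4 p (halfTurn a) u = fun b => if b = a then u b else -u b := by
  have h : ∀ a, symMatrix (autVert (halfTurn a)) =
      Matrix.of fun b c => if b = c then if b = a then 1 else -1 else 0 := by decide
  funext b
  rw [rho4_apply, h]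
  simp only [Matrix.of_apply]
  rw [Finset.sum_eq_single b]
  · rw [if_pos rfl]
    split_ifs <;> simp
  · intro c _ hc
    simp [hc.symm]
  · simp

theorem rho4_threeTurn (u : Fin 3 → ZMod p) : rho4 p threeTurn u = fun b => u (b - 1) := by
  have h : symMatrix (autVert threeTurn) = Matrix.of fun b c => if c = b - 1 then 1 else 0 := by
    decide
  funext b
  rw [rho4_apply, h]
  simp

/-- Submodules of `ρ₁ ⊕ ρ₄ ⊕ ρ₄` invariant under the group. -/
def Invariant (W : Submodule (ZMod p) (Mod p)) : Prop := ∀ g, ∀ x ∈ W, modRep p g x ∈ W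

/-- The elements of `ρ₄ ⊕ ρ₄` in the isotypic component of the `a`-th character of the Klein
four-group. -/
def axis (a : Fin 3) (r s : ZMod p) : Mod p := (0, Pi.single a r, Pi.single a s)

/-- The rotation of order three permutes the coordinate axes cyclically, simultaneously in both
copies of `ρ₄`. -/
theorem axis_mem_iff {W : Submodule (ZMod p) (Mod p)} (hW : Invariant W) (a : Fin 3)
    (r s : ZMod p) : axis a r s ∈ W ↔ axis 0 r s ∈ W := by
  have step : ∀ a, axis a r s ∈ W → axis (a + 1) r s ∈ W := by
    intro a h
    have := hW threeTurn _ h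
    rw [modRep_apply, rho4_threeTurn, rho4_threeTurn] at this
    convert this using 1
    have e : ∀ x : ZMod p, (Pi.single (a + 1) x : Fin 3 → ZMod p) =
        fun b => (Pi.single a x : Fin 3 → ZMod p) (b - 1) := by
      intro x
      funext b
      simp only [Pi.single_apply, sub_eq_iff_eq_add]
    exact Prod.ext rfl (Prod.ext (e r) (e s))
  have h0 := step 0
  have h1 := step 1
  have h2 := step 2
  fin_cases a
  · rfl
  · exact ⟨fun h => h2 (h1 h), h0⟩
  · exact ⟨h2, fun h => h1 (h0 h)⟩

/-- The signed sums of `x` and its images under the half-turns are `4` times its projections to the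
four characters of the Klein four-group. Since `4` is invertible, `W` contains each projection, and
the three axes are then moved to one. -/
theorem mem_iff (hp : p ≠ 2) {W : Submodule (ZMod p) (Mod p)} (hW : Invariant W) (x : Mod p) :
    x ∈ W ↔ (x.1, 0, 0) ∈ W ∧ ∀ a, axis 0 (x.2.1 a) (x.2.2 a) ∈ W := by
  have h4 := zmod_four_ne_zero hp
  constructor
  · intro hx
    have h0 := hW (halfTurn 0) _ hx
    have h1 := hW (halfTurn 1) _ hx
    have h2 := hW (halfTurn 2) _ hx
    simp only [modRep_apply, rho4_halfTurn] at h0 h1 h2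
    have div : ∀ y : Mod p, (4 : ZMod p) • y ∈ W → y ∈ W := fun y hy => by
      have := W.smul_mem 4⁻¹ hy
      rwa [smul_smul, inv_mul_cancel₀ h4, one_smul] at this
    have hc : ∀ a, axis a (x.2.1 a) (x.2.2 a) ∈ W := by
      intro a
      apply div
      fin_cases a
      · convert W.sub_mem (W.sub_mem (W.add_mem hx h0) h1) h2 using 1
        refine Prod.ext ?_ (Prod.ext (funext fun b => ?_) (funext fun b => ?_))
        · simp [axis]
        · fin_cases b <;> simp [axis] <;> ring
        · fin_cases b <;> simp [axis] <;> ring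
      · convert W.sub_mem (W.sub_mem (W.add_mem hx h1) h0) h2 using 1
        refine Prod.ext ?_ (Prod.ext (funext fun b => ?_) (funext fun b => ?_))
        · simp [axis]
        · fin_cases b <;> simp [axis] <;> ring
        · fin_cases b <;> simp [axis] <;> ring
      · convert W.sub_mem (W.sub_mem (W.add_mem hx h2) h0) h1 using 1
        refine Prod.ext ?_ (Prod.ext (funext fun b => ?_) (funext fun b => ?_))
        · simp [axis]
        · fin_cases b <;> simp [axis] <;> ring
        · fin_cases b <;> simp [axis] <;> ring
    refine ⟨div _ ?_, fun a => (axis_mem_iff hW a _ _).1 (hc a)⟩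
    convert W.add_mem (W.add_mem (W.add_mem hx h0) h1) h2 using 1
    refine Prod.ext ?_ (Prod.ext (funext fun b => ?_) (funext fun b => ?_))
    · simp; ring
    · fin_cases b <;> simp
    · fin_cases b <;> simp
  · rintro ⟨ht, ha⟩
    have ha' : ∀ a, axis a (x.2.1 a) (x.2.2 a) ∈ W := fun a => (axis_mem_iff hW a _ _).2 (ha a)
    convert W.add_mem (W.add_mem (W.add_mem ht (ha' 0)) (ha' 1)) (ha' 2) using 1
    refine Prod.ext ?_ (Prod.ext (funext fun b => ?_) (funext fun b => ?_))
    · simp [axis]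
    · fin_cases b <;> simp [axis]
    · fin_cases b <;> simp [axis]

/-- Pulled back to the last summand of `Mod p`, `U` falls under `mem_iff`. One nonzero coordinate of
one element then scales to every value, which gives all vectors. -/
theorem rho4_isIrreducible (hp : p ≠ 2) : (rho4 p).IsIrreducible := by
  have key : ∀ U : Subrepresentation (rho4 p), ∀ u ∈ U.toSubmodule, u ≠ 0 →
      U.toSubmodule = ⊤ := by
    intro U u hu hu0
    let W : Submodule (ZMod p) (Mod p) :=
      U.toSubmodule.comap (LinearMap.snd (ZMod p) _ _ ∘ₗ LinearMap.snd (ZMod p) _ _)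
    have hW : Invariant W := fun g x hx => U.apply_mem_toSubmodule g hx
    have hmem : ∀ v, v ∈ U.toSubmodule ↔ ∀ a, Pi.single 0 (v a) ∈ U.toSubmodule := fun v =>
      (mem_iff hp hW (0, 0, v)).trans (and_iff_right U.toSubmodule.zero_mem)
    obtain ⟨a, ha⟩ := Function.ne_iff.1 hu0
    refine eq_top_iff.2 fun v _ => (hmem v).2 fun b => ?_
    have := U.toSubmodule.smul_mem (v b * (u a)⁻¹) ((hmem u).1 hu a)
    rw [← Pi.single_smul, smul_eq_mul, mul_assoc, inv_mul_cancel₀ ha, mul_one] at this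
    exact this
  refine { exists_pair_ne := ⟨⊥, ⊤, fun h => ?_⟩, eq_bot_or_eq_top := fun U => ?_ }
  · have h1 : (Pi.single 0 1 : Fin 3 → ZMod p) ∈ (⊤ : Subrepresentation (rho4 p)) := trivial
    rw [← h] at h1
    have := congrFun (show (Pi.single 0 1 : Fin 3 → ZMod p) = 0 from h1) 0
    simp at this
  · by_cases h : ∃ u ∈ U.toSubmodule, u ≠ 0
    · obtain ⟨u, hu, hu0⟩ := h
      exact Or.inr (Subrepresentation.toSubmodule_injective (key U u hu hu0))
    · push Not at h
      refine Or.inl (Subrepresentation.toSubmodule_injective ?_)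
      exact (Submodule.eq_bot_iff _).2 h

/-! ### Coverings of the tetrahedron by their kernels: branching, reflection and duality. -/

section Kernel

variable (hp : p ≠ 2) {N N' : ElemAbCover p tetrahedron} {W W' : Submodule (ZMod p) (Mod p)}

/-- The covering group of `N` is the quotient of the homology module by `W`. -/
def HasKernel (N : ElemAbCover p tetrahedron) (W : Submodule (ZMod p) (Mod p)) : Prop :=
  N.Realizes (W.mkQ ∘ₗ (modEquiv hp).symm.toLinearMap)

theorem ker_comp_modEquiv {K : Type} [AddCommGroup K] [Module (ZMod p) K]
    (f : Mod p →ₗ[ZMod p] K) : LinearMap.ker (f ∘ₗ (modEquiv hp).symm.toLinearMap) =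
      (LinearMap.ker f).comap (modEquiv hp).symm.toLinearMap := rfl

/-- Invariance comes from lifting automorphisms, properness from the nontriviality of the covering
group. `exists_of_invariant` is the converse. -/
theorem exists_hasKernel (N : ElemAbCover p tetrahedron) :
    ∃ W, Invariant W ∧ W ≠ ⊤ ∧ HasKernel hp N W := by
  obtain ⟨K, _, _, θ, h⟩ := N.exists_realizes
  refine ⟨LinearMap.ker (θ ∘ₗ (modEquiv hp).toLinearMap), ?_, ?_, h.of_ker_eq ?_ ?_⟩
  · intro g x hx
    rw [LinearMap.mem_ker, LinearMap.comp_apply, LinearEquiv.coe_coe] at hx ⊢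
    rw [modEquiv_modRep]
    exact h.ker_invariant g hx
  · intro htop
    have := h.nontrivial
    obtain ⟨k, hk⟩ := exists_ne (0 : K)
    obtain ⟨c, rfl⟩ := h.surjective k
    have hc : (modEquiv hp).symm c ∈ LinearMap.ker (θ ∘ₗ (modEquiv hp).toLinearMap) := by
      rw [htop]; trivial
    rw [LinearMap.mem_ker, LinearMap.comp_apply, LinearEquiv.coe_coe,
      LinearEquiv.apply_symm_apply] at hc
    exact hk hc
  · exact (Submodule.mkQ_surjective _).comp (modEquiv hp).symm.surjective
  · rw [ker_comp_modEquiv, Submodule.ker_mkQ]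
    ext c
    simp

theorem exists_of_invariant (hW : Invariant W) (htop : W ≠ ⊤) : ∃ N, HasKernel hp N W := by
  have : Nontrivial (Mod p ⧸ W) := Submodule.Quotient.nontrivial_iff.2 htop
  refine exists_of_surjective orientablyRegular
    ((Submodule.mkQ_surjective _).comp (modEquiv hp).symm.surjective)
    ((modRep p).quotient W hW) fun g c => ?_
  obtain ⟨x, rfl⟩ := (modEquiv hp).surjective c
  rw [← modEquiv_modRep]
  simp only [LinearMap.comp_apply, LinearEquiv.coe_coe, LinearEquiv.symm_apply_apply]
  rfl

variable {hp}

theorem HasKernel.cls_eq_iff (h : HasKernel hp N W) (h' : HasKernel hp N' W') :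
    N.cls = N'.cls ↔ W = W' := by
  rw [Realizes.cls_eq_iff h h', ker_comp_modEquiv, ker_comp_modEquiv, Submodule.ker_mkQ,
    Submodule.ker_mkQ]
  exact (Submodule.comap_injective_of_surjective (modEquiv hp).symm.surjective).eq_iff

theorem HasKernel.realizes {K : Type} [AddCommGroup K] [Module (ZMod p) K]
    (h : HasKernel hp N W) {f : Mod p →ₗ[ZMod p] K} (hf : Function.Surjective f)
    (hk : LinearMap.ker f = W) : N.Realizes (f ∘ₗ (modEquiv hp).symm.toLinearMap) := by
  refine Realizes.of_ker_eq h (hf.comp (modEquiv hp).symm.surjective) ?_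
  rw [ker_comp_modEquiv, ker_comp_modEquiv, Submodule.ker_mkQ, hk]

theorem HasKernel.affords {K : Type} [AddCommGroup K] [Module (ZMod p) K]
    (h : HasKernel hp N W) {f : Mod p →ₗ[ZMod p] K} (hf : Function.Surjective f)
    (hk : LinearMap.ker f = W) (ρ : Representation (ZMod p) tetrahedron.aut K)
    (hρ : ∀ g x, f (modRep p g x) = ρ g (f x)) : N.Affords ρ := by
  refine (h.realizes hf hk).affords ρ fun g c => ?_
  obtain ⟨x, rfl⟩ := (modEquiv hp).surjective c
  rw [← modEquiv_modRep]
  simp only [LinearMap.comp_apply, LinearEquiv.coe_coe, LinearEquiv.symm_apply_apply]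
  exact hρ g x

/-- The class of the loop about a vertex. -/
def vertexLoop (i : Fin 4) : Mod p := (4⁻¹, (4⁻¹ : ZMod p) • posVec p i, 0)

/-- The class of the loop about a face-centre. -/
def faceLoop (i : Fin 4) : Mod p := (4⁻¹, 0, (4⁻¹ : ZMod p) • posVec p i)

theorem minimalPeriod_rot (d : tetrahedron.Dart) :
    Function.minimalPeriod tetrahedron.rot d = 3 := by
  have := Fact.mk Nat.prime_three
  refine Function.minimalPeriod_eq_prime ?_ ?_
  · revert d; unfold Function.IsPeriodicPt Function.IsFixedPt; decide
  · revert d; unfold Function.IsFixedPt; decide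

theorem minimalPeriod_face (d : tetrahedron.Dart) :
    Function.minimalPeriod tetrahedron.face d = 3 := by
  have := Fact.mk Nat.prime_three
  refine Function.minimalPeriod_eq_prime ?_ ?_
  · revert d; unfold Function.IsPeriodicPt Function.IsFixedPt; decide
  · revert d; unfold Function.IsFixedPt; decide

/-- Distinct position vectors have scalar product `-1` and each has square `3`. This is why the
factor `4⁻¹` turns the loops into indicator functions of corners. -/
theorem inv_four_posDot (hp : p ≠ 2) (i j : Fin 4) :
    4⁻¹ + posDot p i ((4⁻¹ : ZMod p) • posVec p j) = if i = j then 1 else 0 := by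
  have h4 := zmod_four_ne_zero hp
  have key : ∀ i j : Fin 4, 1 + ∑ a, pos i a * pos j a = if i = j then 4 else 0 := by decide
  have := congrArg (Int.cast : ℤ → ZMod p) (key i j)
  have h2 : posDot p i ((4⁻¹ : ZMod p) • posVec p j) =
      4⁻¹ * ∑ a, (pos i a : ZMod p) * pos j a := by
    simp only [posDot, posVec, Finset.mul_sum, Pi.smul_apply, smul_eq_mul]
    exact Finset.sum_congr rfl fun a _ => by ring
  push_cast at this
  rw [h2, ← mul_one_add, this]
  split_ifs
  · exact inv_mul_cancel₀ h4
  · simp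

theorem chain_vertexLoop (hp : p ≠ 2) (d : tetrahedron.Dart) :
    chain p (vertexLoop (vert d)) =
      ∑ i ∈ Finset.range 3, Finsupp.single (tetrahedron.rot^[i] d) 1 := by
  have key : ∀ d d' : tetrahedron.Dart, (if d = d' then 1 else 0) +
      (if tetrahedron.rot d = d' then 1 else 0) +
      (if tetrahedron.rot (tetrahedron.rot d) = d' then 1 else 0) =
      if vert d' = vert d then 1 else 0 := by decide
  ext d'
  have hk := congrArg (Nat.cast : ℕ → ZMod p) (key d d')
  push_cast at hk
  rw [chain_apply]
  simp only [vertexLoop]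
  rw [inv_four_posDot hp, ← hk]
  simp [Finset.sum_range_succ, posDot, Finsupp.single_apply]

theorem chain_faceLoop (hp : p ≠ 2) (d : tetrahedron.Dart) :
    chain p (faceLoop (opp (tetrahedron.rot⁻¹ d))) =
      ∑ i ∈ Finset.range 3, Finsupp.single (tetrahedron.rot⁻¹ (tetrahedron.face^[i] d)) 1 := by
  have key : ∀ d d' : tetrahedron.Dart, (if tetrahedron.rot⁻¹ d = d' then 1 else 0) +
      (if tetrahedron.rot⁻¹ (tetrahedron.face d) = d' then 1 else 0) +
      (if tetrahedron.rot⁻¹ (tetrahedron.face (tetrahedron.face d)) = d' then 1 else 0) =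
      if opp d' = opp (tetrahedron.rot⁻¹ d) then 1 else 0 := by decide
  ext d'
  have hk := congrArg (Nat.cast : ℕ → ZMod p) (key d d')
  push_cast at hk
  rw [chain_apply]
  simp only [faceLoop]
  have h0 : posDot p (vert d') 0 = 0 := by simp [posDot]
  rw [h0, add_zero, inv_four_posDot hp, ← hk]
  simp [Finset.sum_range_succ, Finsupp.single_apply]

theorem addOrderOf_mkQ [DecidablePred (· ∈ W)] (x : Mod p) :
    addOrderOf (W.mkQ x) = if x ∈ W then 1 else p := by
  split_ifs with h
  · rw [AddMonoid.addOrderOf_eq_one_iff, Submodule.mkQ_apply, Submodule.Quotient.mk_eq_zero]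
    exact h
  · refine addOrderOf_eq_prime ?_ ?_
    · rw [← Nat.cast_smul_eq_nsmul (ZMod p), CharP.cast_eq_zero, zero_smul]
    · rwa [Ne, Submodule.mkQ_apply, Submodule.Quotient.mk_eq_zero]

theorem HasKernel.minimalPeriod_rot [DecidablePred (· ∈ W)] (h : HasKernel hp N W)
    (n : N.total.Dart) : Function.minimalPeriod N.total.rot n =
      3 * if vertexLoop (vert (N.proj.toFun n)) ∈ W then 1 else p := by
  have := Realizes.minimalPeriod_rot h n (by rw [Tetra.minimalPeriod_rot]; norm_num)
    (modEquiv hp (vertexLoop (vert (N.proj.toFun n))))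
    (by rw [Tetra.minimalPeriod_rot, coe_modEquiv, chain_vertexLoop hp])
  rw [this, Tetra.minimalPeriod_rot, LinearMap.comp_apply, LinearEquiv.coe_coe,
    LinearEquiv.symm_apply_apply, addOrderOf_mkQ]

theorem HasKernel.minimalPeriod_face [DecidablePred (· ∈ W)] (h : HasKernel hp N W)
    (n : N.total.Dart) : Function.minimalPeriod N.total.face n =
      3 * if faceLoop (opp (tetrahedron.rot⁻¹ (N.proj.toFun n))) ∈ W then 1 else p := by
  have := Realizes.minimalPeriod_face h n (by rw [Tetra.minimalPeriod_face]; norm_num)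
    (modEquiv hp (faceLoop (opp (tetrahedron.rot⁻¹ (N.proj.toFun n)))))
    (by rw [Tetra.minimalPeriod_face, coe_modEquiv, chain_faceLoop hp])
  rw [this, Tetra.minimalPeriod_face, LinearMap.comp_apply, LinearEquiv.coe_coe,
    LinearEquiv.symm_apply_apply, addOrderOf_mkQ]

/-- Interchanging the first two coordinates. -/
noncomputable def coordSwap : (Fin 3 → ZMod p) ≃ₗ[ZMod p] (Fin 3 → ZMod p) :=
  LinearEquiv.funCongrLeft (ZMod p) (ZMod p) (Equiv.swap 0 1)

theorem coordSwap_apply (u : Fin 3 → ZMod p) (a : Fin 3) :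
    coordSwap u a = u (Equiv.swap 0 1 a) := rfl

/-- Exchanging the first two coordinates is the reflection that exchanges vertices `1` and `2`. -/
theorem posDot_coordSwap (i : Fin 4) (u : Fin 3 → ZMod p) :
    posDot p (Equiv.swap 1 2 i) (coordSwap u) = posDot p i u := by
  have key : ∀ i a, pos (Equiv.swap 1 2 i) a = pos i (Equiv.swap 0 1 a) := by decide
  simp only [posDot, coordSwap_apply, key]
  exact Equiv.sum_comp (Equiv.swap (0 : Fin 3) 1) fun a => (pos i a : ZMod p) * u a

variable (p) in
/-- The action of a reflection, up to sign. -/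
noncomputable def reflect : Mod p ≃ₗ[ZMod p] Mod p :=
  (LinearEquiv.refl _ _).prodCongr (coordSwap.prodCongr coordSwap)

variable (p) in
/-- The action of a duality, up to sign. -/
noncomputable def dualize : Mod p ≃ₗ[ZMod p] Mod p :=
  (LinearEquiv.refl _ _).prodCongr ((LinearEquiv.prodComm _ _ _).trans
    (coordSwap.prodCongr coordSwap))

/-- A reflection of the tetrahedron on darts. -/
def reflectDart : Equiv.Perm TDart where
  toFun d := ⟨(Equiv.swap 1 2 d.1.1, Equiv.swap 1 2 d.1.2),
    fun e => d.2 ((Equiv.swap 1 2).injective e)⟩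
  invFun d := ⟨(Equiv.swap 1 2 d.1.1, Equiv.swap 1 2 d.1.2),
    fun e => d.2 ((Equiv.swap 1 2).injective e)⟩
  left_inv := by decide
  right_inv := by decide

/-- A duality of the tetrahedron on darts. -/
def dualDart : Equiv.Perm TDart where
  toFun d := ⟨(Equiv.swap 1 2 (next d.1.1 (next d.1.1 d.1.2)), Equiv.swap 1 2 (next d.1.1 d.1.2)),
    by revert d; decide⟩
  invFun d := ⟨(Equiv.swap 1 2 (next d.1.1 d.1.2), Equiv.swap 1 2 (next d.1.2 d.1.1)),
    by revert d; decide⟩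
  left_inv := by decide
  right_inv := by decide

/-- A reflection of the tetrahedron. -/
def reflection : tetrahedron.Iso tetrahedron.mirror where
  toEquiv := reflectDart
  map_rot := by
    have : ∀ d : TDart, reflectDart (trot d) = trot⁻¹ (reflectDart d) := by decide
    exact this
  map_inv _ := rfl

/-- A duality of the tetrahedron. -/
def duality : tetrahedron.Iso tetrahedron.dual where
  toEquiv := dualDart
  map_rot := by
    have : ∀ d : TDart, dualDart (trot d) = (trot * tinv)⁻¹ (dualDart d) := by decide
    exact this
  map_inv := by
    have : ∀ d : TDart, dualDart (tinv d) = tinv (dualDart d) := by decide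
    exact this

theorem mapDomain_reflection (x : Mod p) :
    Finsupp.mapDomain (fun d => tetrahedron.rot⁻¹ (reflection.toEquiv d)) (chain p x) =
      chain p (reflect p x) := by
  have hv : ∀ d : tetrahedron.Dart,
      vert (trot⁻¹ (reflectDart d) : TDart) = Equiv.swap 1 2 (vert d) := by decide
  have ho : ∀ d : tetrahedron.Dart,
      opp (trot⁻¹ (reflectDart d) : TDart) = Equiv.swap 1 2 (opp d) := by decide
  refine mapDomain_chain (reflectDart.trans (trot⁻¹ : Equiv.Perm TDart)) fun d => ?_
  rw [chain_apply, chain_apply]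
  refine congrArg₂ (· + ·) (congrArg₂ (· + ·) rfl ?_) ?_
  · exact (congrArg (fun i => posDot p i _) (hv d)).trans (posDot_coordSwap _ _)
  · exact (congrArg (fun i => posDot p i _) (ho d)).trans (posDot_coordSwap _ _)

/-- A duality exchanges `vert` and `opp`, hence the two copies of `ρ₄`. -/
theorem mapDomain_duality (x : Mod p) :
    Finsupp.mapDomain (fun d => tetrahedron.rot⁻¹ (duality.toEquiv d)) (chain p x) =
      chain p (dualize p x) := by
  have hv : ∀ d : tetrahedron.Dart,
      vert (trot⁻¹ (dualDart d) : TDart) = Equiv.swap 1 2 (opp d) := by decide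
  have ho : ∀ d : tetrahedron.Dart,
      opp (trot⁻¹ (dualDart d) : TDart) = Equiv.swap 1 2 (vert d) := by decide
  refine mapDomain_chain (dualDart.trans (trot⁻¹ : Equiv.Perm TDart)) fun d => ?_
  rw [chain_apply, chain_apply, add_right_comm]
  refine congrArg₂ (· + ·) (congrArg₂ (· + ·) rfl ?_) ?_
  · exact (congrArg (fun i => posDot p i _) (ho d)).trans (posDot_coordSwap _ _)
  · exact (congrArg (fun i => posDot p i _) (hv d)).trans (posDot_coordSwap _ _)

/-- The criterion `mem_iff` imposes the same condition on the coordinate pair of every axis, so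
permuting coordinates in both copies at once does not affect membership. -/
theorem map_reflect (hp : p ≠ 2) (hW : Invariant W) : W.map (reflect p).toLinearMap = W := by
  have hmem : ∀ x, reflect p x ∈ W ↔ x ∈ W := by
    intro x
    rw [mem_iff hp hW, mem_iff hp hW x]
    refine and_congr Iff.rfl ?_
    exact (Equiv.swap (0 : Fin 3) 1).forall_congr_left (p := fun a =>
      axis 0 (x.2.1 (Equiv.swap 0 1 a)) (x.2.2 (Equiv.swap 0 1 a)) ∈ W) |>.trans (by simp)
  ext x
  constructor
  · rintro ⟨y, hy, rfl⟩
    exact (hmem y).2 hy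
  · intro hx
    refine ⟨(reflect p).symm x, (hmem _).1 ?_, (reflect p).apply_symm_apply x⟩
    rwa [LinearEquiv.apply_symm_apply]

theorem HasKernel.iso_mirror (h : HasKernel hp N W) (hW : Invariant W) :
    Nonempty (N.total.Iso N.total.mirror) := by
  -- The negation accounts for the reversed direction of the reflected corners.
  refine Realizes.iso_mirror h reflection
    (Submodule.Quotient.equiv W W (reflect p) (map_reflect hp hW) ≪≫ₗ LinearEquiv.neg _) fun c => ?_
  obtain ⟨x, rfl⟩ := (modEquiv hp).surjective c
  refine ⟨modEquiv hp (reflect p x), (mapDomain_reflection x).symm, ?_⟩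
  simp only [LinearMap.comp_apply, LinearEquiv.coe_coe, LinearEquiv.symm_apply_apply]
  rfl

theorem HasKernel.iso_dual (h : HasKernel hp N W) (h' : HasKernel hp N' W')
    (hW : W.map (dualize p).toLinearMap = W') : Nonempty (N.total.Iso N'.total.dual) := by
  refine Realizes.iso_dual h h' duality
    (Submodule.Quotient.equiv W W' (dualize p) hW ≪≫ₗ LinearEquiv.neg _) fun c => ?_
  obtain ⟨x, rfl⟩ := (modEquiv hp).surjective c
  refine ⟨modEquiv hp (dualize p x), (mapDomain_duality x).symm, ?_⟩
  simp only [LinearMap.comp_apply, LinearEquiv.coe_coe, LinearEquiv.symm_apply_apply]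
  rfl

end Kernel

end Tetra

/-! ### Classification and counting of the coverings. -/

namespace Tetra

open OMap OMap.ElemAbCover

section Pencil

variable {p : ℕ} [Fact p.Prime]

/-- The projections of `ρ₄ ⊕ ρ₄` onto `ρ₄`, one for each kernel. -/
def pencil : Option (ZMod p) →
    ((Fin 3 → ZMod p) × (Fin 3 → ZMod p) →ₗ[ZMod p] (Fin 3 → ZMod p))
  | none => LinearMap.fst _ _ _
  | some s => LinearMap.snd _ _ _ - s • LinearMap.fst _ _ _

theorem pencil_some (s : ZMod p) (y : (Fin 3 → ZMod p) × (Fin 3 → ZMod p)) :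
    pencil (some s) y = y.2 - s • y.1 := rfl

theorem pencil_surjective (q : Option (ZMod p)) : Function.Surjective (pencil q) := by
  intro w
  rcases q with _ | s
  · exact ⟨(w, 0), rfl⟩
  · exact ⟨(0, w), by simp [pencil_some]⟩

theorem pencil_rho4 (q : Option (ZMod p)) (g : tetrahedron.aut) (u v : Fin 3 → ZMod p) :
    pencil q (rho4 p g u, rho4 p g v) = rho4 p g (pencil q (u, v)) := by
  rcases q with _ | s
  · rfl
  · simp [pencil_some]

theorem pencil_injective {q q' : Option (ZMod p)}
    (h : ∀ y, pencil q y = 0 ↔ pencil q' y = 0) : q = q' := by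
  rcases q with _ | s <;> rcases q' with _ | s'
  · rfl
  · have := (h (0, fun _ => 1)).1 rfl
    simpa [pencil_some] using congrFun this 0
  · have := (h (0, fun _ => 1)).2 rfl
    simpa [pencil_some] using congrFun this 0
  · have := (h (fun _ => 1, fun _ => s)).1 (by funext a; simp [pencil_some])
    have := congrFun this 0
    simp only [pencil_some, Pi.sub_apply, Pi.smul_apply, smul_eq_mul, mul_one, Pi.zero_apply,
      sub_eq_zero] at this
    rw [this]

/-- A nonzero vector spans a line, and any element off it yields the whole plane. The vertical line
and the lines of slope `s` are matched with `none` and `some s` in `pencil`. -/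
theorem submodule_plane (L : Submodule (ZMod p) (ZMod p × ZMod p)) :
    (∀ y, y ∈ L ↔ y = 0) ∨ (∀ y, y ∈ L) ∨ (∀ y, y ∈ L ↔ y.1 = 0) ∨
      ∃ s, ∀ y, y ∈ L ↔ y.2 - s * y.1 = 0 := by
  by_cases h0 : ∀ y ∈ L, y = 0
  · exact Or.inl fun y => ⟨h0 y, fun h => h ▸ L.zero_mem⟩
  right
  push Not at h0
  obtain ⟨⟨a, b⟩, hab, hne⟩ := h0
  have hsmul : ∀ (r : ZMod p) {y : ZMod p × ZMod p}, y ∈ L → (r * y.1, r * y.2) ∈ L :=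
    fun r y hy => L.smul_mem r hy
  by_cases ha : a = 0
  · have hb : b ≠ 0 := fun hb => hne (by rw [ha, hb]; rfl)
    have h1 : ∀ r, ((0 : ZMod p), r) ∈ L := fun r => by
      have := hsmul (r * b⁻¹) hab
      simpa [ha, mul_assoc, inv_mul_cancel₀ hb] using this
    by_cases h2 : ∀ y ∈ L, y.1 = 0
    · refine Or.inr (Or.inl fun y => ⟨h2 y, fun h => ?_⟩)
      have := h1 y.2
      rwa [← h] at this
    · push Not at h2
      obtain ⟨z, hz, hz1⟩ := h2
      refine Or.inl fun y => ?_
      have := L.add_mem (hsmul (y.1 * z.1⁻¹) hz) (h1 (y.2 - y.1 * z.1⁻¹ * z.2))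
      convert this using 1
      ext <;> simp [mul_assoc, inv_mul_cancel₀ hz1]
  · have h1 : ∀ r, (r, b * a⁻¹ * r) ∈ L := fun r => by
      have := hsmul (r * a⁻¹) hab
      convert this using 2
      · simp [mul_assoc, inv_mul_cancel₀ ha]
      · ring
    by_cases h2 : ∀ y ∈ L, y.2 - b * a⁻¹ * y.1 = 0
    · refine Or.inr (Or.inr ⟨b * a⁻¹, fun y => ⟨h2 y, fun h => ?_⟩⟩)
      have := h1 y.1
      rwa [← sub_eq_zero.1 h] at this
    · push Not at h2
      obtain ⟨z, hz, hz1⟩ := h2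
      refine Or.inl fun y => ?_
      have h3 := L.sub_mem hz (h1 z.1)
      -- `h3` is a nonzero vertical vector. It is scaled to the vertical distance of `y` from the
      -- line and added to the point of the line over `y.1`.
      have h4 := L.add_mem (hsmul ((y.2 - b * a⁻¹ * y.1) * (z.2 - b * a⁻¹ * z.1)⁻¹) h3) (h1 y.1)
      convert h4 using 1
      ext
      · simp
      · simp [mul_assoc, inv_mul_cancel₀ (by simpa [mul_assoc] using hz1 : z.2 - b * (a⁻¹ * z.1) ≠ 0)]

end Pencil

section Classification

variable (p : ℕ) [Fact p.Prime]

/-- The index set of the coverings. -/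
abbrev Index : Type := Unit ⊕ Option (ZMod p) ⊕ Option (ZMod p) ⊕ Unit ⊕ Unit

variable {p}

/-- The invariant proper submodules of `ρ₁ ⊕ ρ₄ ⊕ ρ₄`. -/
def kernel : Index p → Submodule (ZMod p) (Mod p)
  | .inl _ => LinearMap.ker (LinearMap.fst _ _ _)
  | .inr (.inl q) => LinearMap.ker (pencil q ∘ₗ LinearMap.snd _ _ _)
  | .inr (.inr (.inl q)) =>
    LinearMap.ker ((LinearMap.fst _ _ _).prod (pencil q ∘ₗ LinearMap.snd _ _ _))
  | .inr (.inr (.inr (.inl _))) => LinearMap.ker (LinearMap.snd _ _ _)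
  | .inr (.inr (.inr (.inr _))) => LinearMap.ker LinearMap.id

/-- The dimensions of the quotients. -/
def rank : Index p → ℕ
  | .inl _ => 1
  | .inr (.inl _) => 3
  | .inr (.inr (.inl _)) => 4
  | .inr (.inr (.inr (.inl _))) => 6
  | .inr (.inr (.inr (.inr _))) => 7

theorem invariant_ker {K : Type} [AddCommGroup K] [Module (ZMod p) K]
    (ρ : Representation (ZMod p) tetrahedron.aut K) (f : Mod p →ₗ[ZMod p] K)
    (hf : ∀ g x, f (modRep p g x) = ρ g (f x)) : Invariant (LinearMap.ker f) := by
  intro g x hx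
  rw [LinearMap.mem_ker] at hx ⊢
  rw [hf, hx, map_zero]

theorem pencil_modRep (q : Option (ZMod p)) (g : tetrahedron.aut) (x : Mod p) :
    (pencil q ∘ₗ LinearMap.snd _ _ _) (modRep p g x) =
      rho4 p g ((pencil q ∘ₗ LinearMap.snd _ _ _) x) :=
  pencil_rho4 q g x.2.1 x.2.2

theorem prod_pencil_modRep (q : Option (ZMod p)) (g : tetrahedron.aut) (x : Mod p) :
    ((LinearMap.fst _ _ _).prod (pencil q ∘ₗ LinearMap.snd _ _ _)) (modRep p g x) =
      ((rho1 p).prod (rho4 p)) g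
        (((LinearMap.fst _ _ _).prod (pencil q ∘ₗ LinearMap.snd _ _ _)) x) :=
  Prod.ext rfl (pencil_rho4 q g x.2.1 x.2.2)

theorem invariant_kernel (x : Index p) : Invariant (kernel x) := by
  rcases x with _ | q | q | _ | _
  · exact invariant_ker (rho1 p) _ fun _ _ => rfl
  · exact invariant_ker (rho4 p) _ (pencil_modRep q)
  · exact invariant_ker ((rho1 p).prod (rho4 p)) _ (prod_pencil_modRep q)
  · exact invariant_ker ((rho4 p).prod (rho4 p)) _ fun _ _ => rfl
  · exact invariant_ker (modRep p) _ fun _ _ => rfl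

theorem mem_kernel_pencil (q : Option (ZMod p)) (x : Mod p) :
    x ∈ kernel (.inr (.inl q)) ↔ pencil q x.2 = 0 := Iff.rfl

theorem mem_kernel_prod_pencil (q : Option (ZMod p)) (x : Mod p) :
    x ∈ kernel (.inr (.inr (.inl q))) ↔ x.1 = 0 ∧ pencil q x.2 = 0 := Prod.ext_iff

theorem kernel_ne_top (x : Index p) : kernel x ≠ ⊤ := by
  intro h
  have key : ∀ y, y ∈ kernel x := fun y => h ▸ Submodule.mem_top
  have hw : (fun _ => 1 : Fin 3 → ZMod p) ≠ 0 := fun h => one_ne_zero (congrFun h 0)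
  rcases x with _ | q | q | _ | _
  · exact one_ne_zero (α := ZMod p) (key (1, 0, 0))
  · obtain ⟨y, hy⟩ := pencil_surjective q (fun _ => 1)
    exact hw (hy ▸ key (0, y))
  · exact one_ne_zero (α := ZMod p) ((mem_kernel_prod_pencil q _).1 (key (1, 0, 0))).1
  · exact hw (Prod.ext_iff.1 (key (0, fun _ => 1, 0))).1
  · exact one_ne_zero (α := ZMod p) (Prod.ext_iff.1 (key (1, 0, 0))).1

/-- By `mem_iff`, `W` is determined by its trivial part, which is zero or everything, and by the
plane subspace `W.comap ℓ`, where `ℓ (r, s)` is `axis 0 r s`. Of the eight resulting cases only the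
one with both parts full is excluded by `htop`. -/
theorem exists_kernel_eq (hp : p ≠ 2) {W : Submodule (ZMod p) (Mod p)} (hW : Invariant W)
    (htop : W ≠ ⊤) : ∃ x, W = kernel x := by
  let ℓ : ZMod p × ZMod p →ₗ[ZMod p] Mod p := (0 : ZMod p × ZMod p →ₗ[ZMod p] ZMod p).prod
    ((LinearMap.single (ZMod p) (fun _ : Fin 3 => ZMod p) 0 ∘ₗ LinearMap.fst _ _ _).prod
      (LinearMap.single (ZMod p) (fun _ : Fin 3 => ZMod p) 0 ∘ₗ LinearMap.snd _ _ _))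
  have hmem : ∀ x, x ∈ W ↔ (x.1, 0, 0) ∈ W ∧ ∀ a, (x.2.1 a, x.2.2 a) ∈ W.comap ℓ := mem_iff hp hW
  have htriv : (∀ t : ZMod p, ((t, 0, 0) : Mod p) ∈ W) ∨
      ∀ t : ZMod p, ((t, 0, 0) : Mod p) ∈ W ↔ t = 0 := by
    by_cases h : ((1, 0, 0) : Mod p) ∈ W
    · left
      intro t
      simpa using W.smul_mem t h
    · right
      intro t
      refine ⟨fun ht => by_contra fun h0 => h ?_, fun h => h ▸ W.zero_mem⟩
      simpa [inv_mul_cancel₀ h0] using W.smul_mem t⁻¹ ht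
  have hsome : ∀ (s : ZMod p) (y : (Fin 3 → ZMod p) × (Fin 3 → ZMod p)),
      (∀ a, y.2 a - s * y.1 a = 0) ↔ pencil (some s) y = 0 := fun s y => funext_iff.symm
  have hnone : ∀ y : (Fin 3 → ZMod p) × (Fin 3 → ZMod p),
      (∀ a, y.1 a = 0) ↔ pencil none y = 0 := fun y => funext_iff.symm
  have hzero : ∀ y : (Fin 3 → ZMod p) × (Fin 3 → ZMod p),
      (∀ a, (y.1 a, y.2 a) = 0) ↔ y = 0 := by
    intro y
    simp only [Prod.ext_iff, funext_iff, forall_and]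
    rfl
  rcases htriv with ht | ht <;> rcases submodule_plane (W.comap ℓ) with hL | hL | hL | ⟨s, hL⟩
  · refine ⟨.inr (.inr (.inr (.inl ()))), Submodule.ext fun x => ?_⟩
    simp only [hmem x, ht, hL, true_and, hzero]
    rfl
  · exact (htop (eq_top_iff.2 fun x _ => (hmem x).2 ⟨ht _, fun _ => hL _⟩)).elim
  · refine ⟨.inr (.inl none), Submodule.ext fun x => ?_⟩
    simp only [hmem x, ht, hL, true_and, hnone, mem_kernel_pencil]
  · refine ⟨.inr (.inl (some s)), Submodule.ext fun x => ?_⟩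
    simp only [hmem x, ht, hL, true_and, hsome, mem_kernel_pencil]
  · refine ⟨.inr (.inr (.inr (.inr ()))), Submodule.ext fun x => ?_⟩
    simp only [hmem x, ht, hL, hzero]
    exact (Prod.ext_iff (x := x) (y := 0)).symm
  · refine ⟨.inl (), Submodule.ext fun x => ?_⟩
    simp only [hmem x, ht, hL, implies_true, and_true]
    rfl
  · refine ⟨.inr (.inr (.inl none)), Submodule.ext fun x => ?_⟩
    simp only [hmem x, ht, hL, hnone, mem_kernel_prod_pencil]
  · refine ⟨.inr (.inr (.inl (some s))), Submodule.ext fun x => ?_⟩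
    simp only [hmem x, ht, hL, hsome, mem_kernel_prod_pencil]

theorem inv_four_smul_posVec_ne_zero (hp : p ≠ 2) (i : Fin 4) :
    (4⁻¹ : ZMod p) • posVec p i ≠ 0 := by
  intro h
  have h0 := congrFun h 0
  have h4 := inv_ne_zero (zmod_four_ne_zero hp)
  fin_cases i <;> simp [posVec, pos] at h0 <;> exact h4 (by simpa using h0)

/-- A vertex loop has nonzero components in `ρ₁` and the first `ρ₄` only, so it dies exactly in the
projection to the second `ρ₄`. For face loops the roles of the copies are exchanged. -/
theorem vertexLoop_mem_kernel (hp : p ≠ 2) (i : Fin 4) (x : Index p) :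
    vertexLoop i ∈ kernel x ↔ x = .inr (.inl (some 0)) := by
  have h4 := inv_ne_zero (zmod_four_ne_zero hp)
  have hw := inv_four_smul_posVec_ne_zero hp i
  rcases x with _ | q | q | _ | _
  · exact iff_of_false h4 (by simp)
  · rw [mem_kernel_pencil]
    rcases q with _ | s
    · exact iff_of_false hw (by simp)
    · rw [pencil_some]
      simp only [vertexLoop, zero_sub, neg_eq_zero, smul_eq_zero_iff_left hw]
      simp
  · rw [mem_kernel_prod_pencil]
    exact iff_of_false (fun h => h4 h.1) (by simp)
  · exact iff_of_false (fun h => hw (Prod.ext_iff.1 h).1) (by simp)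
  · exact iff_of_false (fun h => h4 (Prod.ext_iff.1 h).1) (by simp)

theorem faceLoop_mem_kernel (hp : p ≠ 2) (i : Fin 4) (x : Index p) :
    faceLoop i ∈ kernel x ↔ x = .inr (.inl none) := by
  have h4 := inv_ne_zero (zmod_four_ne_zero hp)
  have hw := inv_four_smul_posVec_ne_zero hp i
  rcases x with _ | q | q | _ | _
  · exact iff_of_false h4 (by simp)
  · rw [mem_kernel_pencil]
    rcases q with _ | s
    · exact iff_of_true rfl rfl
    · refine iff_of_false (fun h => hw ?_) (by simp)
      rw [pencil_some] at h
      simpa [faceLoop] using h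
  · rw [mem_kernel_prod_pencil]
    exact iff_of_false (fun h => h4 h.1) (by simp)
  · exact iff_of_false (fun h => hw (Prod.ext_iff.1 h).2) (by simp)
  · exact iff_of_false (fun h => h4 (Prod.ext_iff.1 h).1) (by simp)

theorem map_dualize : (kernel (.inr (.inl none)) : Submodule (ZMod p) (Mod p)).map
    (dualize p).toLinearMap = kernel (.inr (.inl (some 0))) := by
  ext x
  constructor
  · rintro ⟨y, hy, rfl⟩
    have hy : y.2.1 = 0 := hy
    rw [mem_kernel_pencil, pencil_some]
    simp [dualize, hy]
  · intro hx
    rw [mem_kernel_pencil, pencil_some] at hx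
    have hx : x.2.2 = 0 := by simpa using hx
    refine ⟨(dualize p).symm x, ?_, (dualize p).apply_symm_apply x⟩
    change coordSwap.symm x.2.2 = 0
    rw [hx, map_zero]

section Covers

variable {hp : p ≠ 2} {N : ElemAbCover p tetrahedron} {x y : Index p}

theorem HasKernel.hasRank_and_affords (h : HasKernel hp N (kernel x)) :
    N.HasRank (rank x) ∧
      match x with
      | .inl _ => N.Affords (rho1 p)
      | .inr (.inl _) => N.Affords (rho4 p)
      | .inr (.inr (.inl _)) => N.Affords ((rho1 p).prod (rho4 p))
      | .inr (.inr (.inr (.inl _))) => N.Affords ((rho4 p).prod (rho4 p))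
      | .inr (.inr (.inr (.inr _))) => N.Affords (modRep p) := by
  have hF : Nat.card (ZMod p) = p := Nat.card_zmod p
  have hV : Nat.card (Fin 3 → ZMod p) = p ^ 3 := by rw [Nat.card_fun, hF]; simp
  rcases x with _ | q | q | _ | _
  · have hs : Function.Surjective (LinearMap.fst (ZMod p) (ZMod p)
        ((Fin 3 → ZMod p) × (Fin 3 → ZMod p))) := LinearMap.fst_surjective
    exact ⟨(h.realizes hs rfl).hasRank (by rw [hF, rank, pow_one]),
      h.affords hs rfl (rho1 p) fun _ _ => rfl⟩
  · have hs : Function.Surjective (pencil q ∘ₗ LinearMap.snd (ZMod p) (ZMod p)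
        ((Fin 3 → ZMod p) × (Fin 3 → ZMod p))) :=
      (pencil_surjective q).comp LinearMap.snd_surjective
    exact ⟨(h.realizes hs rfl).hasRank (by rw [hV, rank]),
      h.affords hs rfl (rho4 p) (pencil_modRep q)⟩
  · have hs : Function.Surjective ((LinearMap.fst (ZMod p) (ZMod p) _).prod
        (pencil q ∘ₗ LinearMap.snd (ZMod p) (ZMod p)
          ((Fin 3 → ZMod p) × (Fin 3 → ZMod p)))) := by
      rintro ⟨t, w⟩
      obtain ⟨z, rfl⟩ := pencil_surjective q w
      exact ⟨(t, z), rfl⟩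
    exact ⟨(h.realizes hs rfl).hasRank (by rw [Nat.card_prod, hV, hF, rank]; ring),
      h.affords hs rfl _ (prod_pencil_modRep q)⟩
  · have hs : Function.Surjective (LinearMap.snd (ZMod p) (ZMod p)
        ((Fin 3 → ZMod p) × (Fin 3 → ZMod p))) := LinearMap.snd_surjective
    exact ⟨(h.realizes hs rfl).hasRank (by rw [Nat.card_prod, hV, rank]; ring),
      h.affords hs rfl _ fun _ _ => rfl⟩
  · have hs : Function.Surjective (LinearMap.id : Mod p →ₗ[ZMod p] Mod p) :=
      Function.surjective_id
    exact ⟨(h.realizes hs rfl).hasRank (by rw [Nat.card_prod, Nat.card_prod, hV, hF, rank]; ring),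
      h.affords hs rfl _ fun _ _ => rfl⟩

theorem hasRank_unique {c c' : ℕ} (h : N.HasRank c) (h' : N.HasRank c') : c = c' :=
  Nat.pow_right_injective (Fact.out (p := p.Prime)).two_le (h.symm.trans h')

/-- A cover with the given kernel has a well-defined rank, which separates the five families; within
a family the kernel of `pencil q` recovers `q`. -/
theorem kernel_injective (hp : p ≠ 2) : Function.Injective (kernel : Index p → _) := by
  intro x y hxy
  obtain ⟨N, hN⟩ := exists_of_invariant hp (invariant_kernel x) (kernel_ne_top x)
  have hN' : HasKernel hp N (kernel y) := hxy ▸ hN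
  have hr := hasRank_unique hN.hasRank_and_affords.1 hN'.hasRank_and_affords.1
  rcases x with _ | q | q | _ | _ <;> rcases y with _ | q' | q' | _ | _ <;>
    simp only [rank] at hr <;> first | rfl | omega | skip
  · rw [pencil_injective (q := q) (q' := q') fun z => by
      have := SetLike.ext_iff.1 hxy (0, z)
      exact this]
  · rw [pencil_injective (q := q) (q' := q') fun z => by
      have := SetLike.ext_iff.1 hxy (0, z)
      rw [mem_kernel_prod_pencil, mem_kernel_prod_pencil] at this
      simpa using this]

theorem exists_hasKernel_kernel (hp : p ≠ 2) (N : ElemAbCover p tetrahedron) :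
    ∃ x, HasKernel hp N (kernel x) := by
  obtain ⟨W, hW, htop, h⟩ := exists_hasKernel hp N
  obtain ⟨x, rfl⟩ := exists_kernel_eq hp hW htop
  exact ⟨x, h⟩

variable (hp) in
/-- The covering with a given index. -/
noncomputable def cover (x : Index p) : ElemAbCover p tetrahedron :=
  (exists_of_invariant hp (invariant_kernel x) (kernel_ne_top x)).choose

theorem hasKernel_cover (x : Index p) : HasKernel hp (cover hp x) (kernel x) :=
  (exists_of_invariant hp (invariant_kernel x) (kernel_ne_top x)).choose_spec

theorem HasKernel.cls_eq_cover (h : HasKernel hp N (kernel x)) :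
    N.cls = (cover hp y).cls ↔ x = y := by
  rw [h.cls_eq_iff (hasKernel_cover y), (kernel_injective hp).eq_iff]

theorem cls_cover_bijective (hp : p ≠ 2) :
    Function.Bijective (fun x : Index p => (cover hp x).cls) := by
  refine ⟨fun x y h => (hasKernel_cover x).cls_eq_cover.1 h, fun q => ?_⟩
  induction q using Quotient.inductionOn with | _ N
  obtain ⟨x, hx⟩ := exists_hasKernel_kernel hp N
  exact ⟨x, (hx.cls_eq_cover.2 rfl).symm⟩

theorem card_classes (hp : p ≠ 2) : Nat.card (Classes p tetrahedron) = 2 * p + 5 := by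
  rw [← Nat.card_eq_of_bijective _ (cls_cover_bijective hp)]
  simp
  ring

/-- `ι` parametrizes the indices of rank `c`; as every cover has an index and its rank is unique,
these are all the classes of that rank. -/
theorem card_classesOfRank (hp : p ≠ 2) {Q : Type} {c : ℕ} (ι : Q → Index p)
    (hι : Function.Injective ι) (h : ∀ x, rank x = c ↔ ∃ q, ι q = x) :
    Nat.card (ClassesOfRank p tetrahedron c) = Nat.card Q := by
  have hrank : ∀ x : Index p, (cover hp x).HasRank (rank x) := fun x =>
    (hasKernel_cover x).hasRank_and_affords.1
  let f : Q → ClassesOfRank p tetrahedron c := fun q =>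
    ⟨(cover hp (ι q)).cls, cover hp (ι q), rfl, (h (ι q)).2 ⟨q, rfl⟩ ▸ hrank (ι q)⟩
  refine (Nat.card_eq_of_bijective f ⟨fun q q' hq => hι ?_, ?_⟩).symm
  · exact (cls_cover_bijective hp).1 (congrArg Subtype.val hq)
  · rintro ⟨_, N, rfl, hN⟩
    obtain ⟨x, hx⟩ := exists_hasKernel_kernel hp N
    obtain ⟨q, rfl⟩ := (h x).1 (hasRank_unique hx.hasRank_and_affords.1 hN)
    exact ⟨q, Subtype.ext (hx.cls_eq_cover.2 rfl).symm⟩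

theorem HasKernel.rot_period_eq (h : HasKernel hp N (kernel x)) (n : N.total.Dart) :
    Function.minimalPeriod N.total.rot n = if x = .inr (.inl (some 0)) then 3 else 3 * p := by
  classical
  rw [h.minimalPeriod_rot]
  simp only [vertexLoop_mem_kernel hp]
  split_ifs <;> simp

theorem HasKernel.face_period_eq (h : HasKernel hp N (kernel x)) (n : N.total.Dart) :
    Function.minimalPeriod N.total.face n = if x = .inr (.inl none) then 3 else 3 * p := by
  classical
  rw [h.minimalPeriod_face]
  simp only [faceLoop_mem_kernel hp]
  split_ifs <;> simp

theorem unbranchedOverVertices_iff (hp : p ≠ 2) (N : ElemAbCover p tetrahedron) :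
    N.UnbranchedOverVertices ↔ N.cls = (cover hp (.inr (.inl (some 0)))).cls := by
  obtain ⟨x, hx⟩ := exists_hasKernel_kernel hp N
  rw [hx.cls_eq_cover]
  simp only [UnbranchedOverVertices, hx.rot_period_eq, Tetra.minimalPeriod_rot]
  have := (Fact.out (p := p.Prime)).two_le
  have := N.total.nonempty_dart
  rw [forall_const]
  split_ifs with h
  · simp [h]
  · exact iff_of_false (by omega) h

theorem unbranchedOverFaces_iff (hp : p ≠ 2) (N : ElemAbCover p tetrahedron) :
    N.UnbranchedOverFaces ↔ N.cls = (cover hp (.inr (.inl none))).cls := by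
  obtain ⟨x, hx⟩ := exists_hasKernel_kernel hp N
  rw [hx.cls_eq_cover]
  simp only [UnbranchedOverFaces, hx.face_period_eq, Tetra.minimalPeriod_face]
  have := (Fact.out (p := p.Prime)).two_le
  have := N.total.nonempty_dart
  rw [forall_const]
  split_ifs with h
  · simp [h]
  · exact iff_of_false (by omega) h

theorem HasKernel.card_dart (h : HasKernel hp N (kernel x)) {c : ℕ} (hc : N.HasRank c) :
    Nat.card N.total.Dart = 12 * p ^ c := by
  have h1 := h.card_deck
  have h2 : N.HasRank c := hc
  obtain ⟨ν, P, -, -⟩ := h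
  rw [← Nat.card_congr P.e, Nat.card_prod, ← h1, h2, Nat.card_eq_fintype_card]
  rfl

end Covers

end Classification

end Tetra

/-! ### Euler characteristic and the final theorem. -/

namespace OMap

theorem card_edge_mul_two (M : OMap) : Nat.card M.Edge * 2 = Nat.card M.Dart := by
  have := Fact.mk Nat.prime_two
  exact card_cycles_mul M.inv fun d =>
    Function.minimalPeriod_eq_prime (M.inv_inv d) (M.inv_ne d)

/-- The Euler characteristic in terms of the type of a map. -/
theorem HasType.hasGenus {M : OMap} {n m a b e : ℕ} (h : M.HasType n m) (hn : 0 < n) (hm : 0 < m)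
    (ha : Nat.card M.Dart = a * m) (hb : Nat.card M.Dart = b * n) (he : Nat.card M.Dart = e * 2)
    {g : ℤ} (hg : (a : ℤ) - e + b = 2 - 2 * g) : M.HasGenus g := by
  have h1 := card_cycles_mul M.rot h.2
  have h2 := card_cycles_mul M.face h.1
  have h3 := M.card_edge_mul_two
  rw [ha] at h1
  rw [hb] at h2
  rw [he] at h3
  rw [HasGenus, Nat.eq_of_mul_eq_mul_right hm h1, Nat.eq_of_mul_eq_mul_right hn h2,
    Nat.eq_of_mul_eq_mul_right two_pos h3]
  exact hg

end OMap

open OMap OMap.ElemAbCover Tetra in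
theorem mainTheorem2 (p : ℕ) [Fact p.Prime] (hp2 : p ≠ 2) :
    -- the homology module of the punctured sphere
    Nonempty ((homologyRep p tetrahedron).Equiv (punctureQuotientRep p tetrahedron)) ∧
    Nonempty ((homologyRep p tetrahedron).Equiv ((rho1 p).prod ((rho4 p).prod (rho4 p)))) ∧
    (rho4 p).IsIrreducible ∧
    -- the number of coverings, in total and by rank
    Nat.card (Classes p tetrahedron) = 2 * p + 5 ∧
    Nat.card (ClassesOfRank p tetrahedron 1) = 1 ∧
    Nat.card (ClassesOfRank p tetrahedron 3) = p + 1 ∧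
    Nat.card (ClassesOfRank p tetrahedron 4) = p + 1 ∧
    Nat.card (ClassesOfRank p tetrahedron 6) = 1 ∧
    Nat.card (ClassesOfRank p tetrahedron 7) = 1 ∧
    -- non-isomorphic coverings are non-isomorphic as maps
    (∀ N N' : ElemAbCover p tetrahedron, Nonempty (N.total.Iso N'.total) → N.cls = N'.cls) ∧
    -- all of them are regular
    (∀ N : ElemAbCover p tetrahedron, N.total.IsRegular) ∧
    -- the representations they afford
    (∀ N : ElemAbCover p tetrahedron,
      (N.HasRank 1 ∧ N.Affords (rho1 p)) ∨
      (N.HasRank 3 ∧ N.Affords (rho4 p)) ∨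
      (N.HasRank 4 ∧ N.Affords ((rho1 p).prod (rho4 p))) ∨
      (N.HasRank 6 ∧ N.Affords ((rho4 p).prod (rho4 p))) ∨
      (N.HasRank 7 ∧ N.Affords ((rho1 p).prod ((rho4 p).prod (rho4 p))))) ∧
    -- the two coverings branched only over faces or only over vertices, and the remaining ones
    ∃ NF NV : ElemAbCover p tetrahedron,
      (∀ N : ElemAbCover p tetrahedron, N.UnbranchedOverVertices ↔ N.cls = NF.cls) ∧
      (∀ N : ElemAbCover p tetrahedron, N.UnbranchedOverFaces ↔ N.cls = NV.cls) ∧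
      NF.HasRank 3 ∧ NV.HasRank 3 ∧
      NF.total.HasType (3 * p) 3 ∧ NV.total.HasType 3 (3 * p) ∧
      NF.total.HasGenus ((p : ℤ) ^ 3 - 2 * (p : ℤ) ^ 2 + 1) ∧
      NV.total.HasGenus ((p : ℤ) ^ 3 - 2 * (p : ℤ) ^ 2 + 1) ∧
      Nonempty (NV.total.Iso NF.total.dual) ∧
      ∀ N : ElemAbCover p tetrahedron, N.cls ≠ NF.cls → N.cls ≠ NV.cls →
        N.total.HasType (3 * p) (3 * p) ∧
        ∀ c : ℕ, N.HasRank c →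
          N.total.HasGenus (3 * (p : ℤ) ^ c - 4 * (p : ℤ) ^ (c - 1) + 1) := by
  have hp0 : 0 < p := (Fact.out (p := p.Prime)).pos
  have hrank : ∀ {N : ElemAbCover p tetrahedron} {x}, HasKernel hp2 N (kernel x) →
      N.HasRank (rank x) := fun h => h.hasRank_and_affords.1
  -- Index `none` projects to the first `ρ₄`, killing face loops; index `some 0` projects to the
  -- second, killing vertex loops.
  have hV := hasKernel_cover (hp := hp2) (.inr (.inl none))
  have hF := hasKernel_cover (hp := hp2) (.inr (.inl (some 0)))
  have hVtype : (cover hp2 (.inr (.inl none))).total.HasType 3 (3 * p) :=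
    ⟨fun d => by rw [hV.face_period_eq, if_pos rfl],
      fun d => by rw [hV.rot_period_eq, if_neg (by simp)]⟩
  have hFtype : (cover hp2 (.inr (.inl (some 0)))).total.HasType (3 * p) 3 :=
    ⟨fun d => by rw [hF.face_period_eq, if_neg (by simp)],
      fun d => by rw [hF.rot_period_eq, if_pos rfl]⟩
  refine ⟨homologyRep_equiv_punctureQuotientRep hp2, homologyRep_equiv_modRep hp2,
    rho4_isIrreducible hp2, card_classes hp2, ?_, ?_, ?_, ?_, ?_,
    fun N N' ⟨φ⟩ => cls_eq_of_iso orientablyRegular φ, fun N => ⟨N.orientablyRegular, ?_⟩,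
    fun N => ?_, cover hp2 (.inr (.inl (some 0))), cover hp2 (.inr (.inl none)),
    unbranchedOverVertices_iff hp2, unbranchedOverFaces_iff hp2, hrank hF, hrank hV,
    hFtype, hVtype, ?_, ?_, hV.iso_dual hF map_dualize, fun N hNF hNV => ?_⟩
  · rw [card_classesOfRank hp2 (Q := Unit) Sum.inl Sum.inl_injective]
    · simp
    · rintro (_ | q | q | _ | _) <;> simp [rank]
  · rw [card_classesOfRank hp2 (Q := Option (ZMod p)) (fun q => .inr (.inl q))
      (Sum.inr_injective.comp Sum.inl_injective)]
    · simp
    · rintro (_ | q | q | _ | _) <;> simp [rank]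
  · rw [card_classesOfRank hp2 (Q := Option (ZMod p)) (fun q => .inr (.inr (.inl q)))
      (Sum.inr_injective.comp (Sum.inr_injective.comp Sum.inl_injective))]
    · simp
    · rintro (_ | q | q | _ | _) <;> simp [rank]
  · rw [card_classesOfRank hp2 (Q := Unit) (fun q => .inr (.inr (.inr (.inl q))))
      fun _ _ _ => rfl]
    · simp
    · rintro (_ | q | q | _ | _) <;> simp [rank]
  · rw [card_classesOfRank hp2 (Q := Unit) (fun q => .inr (.inr (.inr (.inr q))))
      fun _ _ _ => rfl]
    · simp
    · rintro (_ | q | q | _ | _) <;> simp [rank]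
  · obtain ⟨x, hx⟩ := exists_hasKernel_kernel hp2 N
    exact hx.iso_mirror (invariant_kernel x)
  · obtain ⟨x, hx⟩ := exists_hasKernel_kernel hp2 N
    have := hx.hasRank_and_affords
    rcases x with _ | q | q | _ | _
    · exact Or.inl this
    · exact Or.inr (Or.inl this)
    · exact Or.inr (Or.inr (Or.inl this))
    · exact Or.inr (Or.inr (Or.inr (Or.inl this)))
    · exact Or.inr (Or.inr (Or.inr (Or.inr this)))
  · have hcard := hF.card_dart (hrank hF)
    -- There are `12 * p ^ 3` darts: dividing by the valency `3`, the face length `3 * p` and by `2`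
    -- counts vertices, faces and edges.
    refine hFtype.hasGenus (a := 4 * p ^ 3) (b := 4 * p ^ 2) (e := 6 * p ^ 3) (by omega) (by omega)
      (hcard.trans ?_) (hcard.trans ?_) (hcard.trans ?_) ?_
    · rw [rank]; ring
    · rw [rank]; ring
    · rw [rank]; ring
    · push_cast; ring
  · have hcard := hV.card_dart (hrank hV)
    refine hVtype.hasGenus (a := 4 * p ^ 2) (b := 4 * p ^ 3) (e := 6 * p ^ 3) (by omega) (by omega)
      (hcard.trans ?_) (hcard.trans ?_) (hcard.trans ?_) ?_
    · rw [rank]; ring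
    · rw [rank]; ring
    · rw [rank]; ring
    · push_cast; ring
  · obtain ⟨x, hx⟩ := exists_hasKernel_kernel hp2 N
    rw [Ne, hx.cls_eq_cover] at hNF hNV
    have htype : N.total.HasType (3 * p) (3 * p) :=
      ⟨fun d => by rw [hx.face_period_eq, if_neg hNV],
        fun d => by rw [hx.rot_period_eq, if_neg hNF]⟩
    refine ⟨htype, fun c hc => ?_⟩
    have hcard := hx.card_dart hc
    -- The rank is positive, so the subtraction in `p ^ (c - 1)` is not truncated.
    have hc0 : c ≠ 0 := by
      rw [hasRank_unique hc (hrank hx)]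
      rcases x with _ | q | q | _ | _ <;> simp [rank]
    obtain ⟨c, rfl⟩ := Nat.exists_eq_succ_of_ne_zero hc0
    refine htype.hasGenus (a := 4 * p ^ c) (b := 4 * p ^ c) (e := 6 * p ^ (c + 1)) (by omega)
      (by omega) (hcard.trans ?_) (hcard.trans ?_) (hcard.trans ?_) ?_
    · rw [Nat.succ_eq_add_one]; ring
    · rw [Nat.succ_eq_add_one]; ring
    · rw [Nat.succ_eq_add_one]; ring
    · simp only [Nat.succ_eq_add_one, Nat.add_sub_cancel]
      push_cast
      ring
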